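/- Let $\mathbf{FI}$ be the category of finite sets and injections; an $\mathbf{FI}$-module is a functor from $\mathbf{FI}$ to abelian groups. For an $\mathbf{FI}$-module $W$ let $\deg W\in\{-1,0,1,\dots\}\cup\{\infty\}$ be the least $d\ge -1$ such that $W_S=0$ for all finite sets $S$ with $|S|>d$. Let $\mathrm H_0(V)_S=\operatorname{coker}\bigl(\bigoplus_{A\subsetneq S}V_A\to V_S\bigr)$, let $\mathrm H_i$ be the $i$-th left derived functor of $\mathrm H_0$, and say that $V$ is presented in finite degrees if $\deg \mathrm H_0(V)$ and $\deg \mathrm H_1(V)$ are both finite. Let $\mathbf\Delta V=\operatorname{coker}(V\to \mathbf\Sigma V)$, where $(\mathbf\Sigma V)_S=V_{S\sqcup\{*\}}$ and the map is induced by the inclusions $S\hookrightarrow S\sqcup\{*\}$; let $\mathbf\Delta^a$ be the $a$-fold composite of $\mathbf\Delta$ and $\mathrm L_i\mathbf\Delta^a$ its $i$-th left derived functor. Let $\mathrm H^0_{\mathfrak m}(V)$ be the largest torsion $\mathbf{FI}$-submodule of $V$ (the elements $x\in V_S$ with $V_\alpha(x)=0$ for some injection $\alpha\colon S\hookrightarrow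 T$), let $\mathrm H^j_{\mathfrak m}$ be the $j$-th right derived functor of $\mathrm H^0_{\mathfrak m}$, and set $h^j(V)=\deg \mathrm H^j_{\mathfrak m}(V)$. Let $V$ be an $\mathbf{FI}$-module presented in finite degrees. Then: (1) For every $a\ge 0$ and $u\ge 0$, if $h^u(\mathbf\Delta^aV)\ge 0$, then $$h^u(\mathbf\Delta^aV)+u+a\le\max\{h^j(V)+j : h^j(V)\ge 0 \text{ and } 0\le j\le u+a\}.$$ (2) For every $a\ge 1$ and $i\ge 1$, if $\mathrm L_i\mathbf\Delta^a(V)\ne 0$, then $$\deg \mathrm L_i\mathbf\Delta^a(V)+a\le\max\{h^j(V)+j+i : h^j(V)\ge 0 \text{ and } 0\le j\le a-i\}.$$ In both parts the set on the right-hand side is, under the stated hypothesis, nonempty. -/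

import Mathlib

open CategoryTheory CategoryTheory.Limits

universe u

/-- Objects of the category `FI`: finite sets. -/
structure FI : Type (u + 1) where
  carrier : Type u
  finite : Finite carrier

namespace FI

instance (S : FI.{u}) : Finite S.carrier := S.finite

/-- Morphisms of `FI` are injections. -/
instance : Category.{u} FI.{u} where
  Hom S T := S.carrier ↪ T.carrier
  id S := Function.Embedding.refl S.carrier
  comp f g := Function.Embedding.trans f g

/-- A subset of a finite set, as a finite set. -/
def sub {S : FI.{u}} (A : Set S.carrier) : FI.{u} := ⟨A, inferInstance⟩

/-- The inclusion of a subset. -/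
def incl {S : FI.{u}} (A : Set S.carrier) : sub A ⟶ S := Function.Embedding.subtype (· ∈ A)

/-- The functor `S ↦ S ⊔ {*}`. -/
def addPoint : FI.{u} ⥤ FI.{u} where
  obj S := ⟨Option S.carrier, inferInstance⟩
  map f := Function.Embedding.optionMap f
  map_id S := by
    apply Function.Embedding.ext
    rintro (_ | x) <;> rfl
  map_comp f g := by
    apply Function.Embedding.ext
    rintro (_ | x) <;> rfl

/-- The natural inclusion `S ⊆ S ⊔ {*}`. -/
def inclPoint : 𝟭 FI.{u} ⟶ addPoint where
  app S := (Function.Embedding.some : S.carrier ↪ Option S.carrier)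
  naturality S T f := by
    apply Function.Embedding.ext
    intro x
    rfl

/-- Two injections out of `S` can be completed to a commutative square. -/
lemma exists_square {S T U : FI.{u}} (f : S ⟶ T) (g : S ⟶ U) :
    ∃ (W : FI.{u}) (p : T ⟶ W) (q : U ⟶ W), f ≫ p = g ≫ q := by
  classical
  let f' : S.carrier ↪ T.carrier := f
  let g' : S.carrier ↪ U.carrier := g
  let q : U.carrier → T.carrier ⊕ U.carrier := fun y =>
    if h : ∃ x, g' x = y then Sum.inl (f' h.choose) else Sum.inr y
  have hq : ∀ x, q (g' x) = Sum.inl (f' x) := by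
    intro x
    have h : ∃ x', g' x' = g' x := ⟨x, rfl⟩
    have : h.choose = x := g'.injective h.choose_spec
    simp only [q, dif_pos h, this]
  have qinj : Function.Injective q := by
    intro y z hyz
    by_cases hy : ∃ x, g' x = y <;> by_cases hz : ∃ x, g' x = z
    · obtain ⟨x, rfl⟩ := hy
      obtain ⟨x', rfl⟩ := hz
      rw [hq, hq] at hyz
      rw [f'.injective (Sum.inl.inj hyz)]
    · obtain ⟨x, rfl⟩ := hy
      rw [hq] at hyz
      simp [q, dif_neg hz] at hyz
    · obtain ⟨x', rfl⟩ := hz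
      rw [hq] at hyz
      simp [q, dif_neg hy] at hyz
    · simpa [q, dif_neg hy, dif_neg hz] using hyz
  refine ⟨⟨T.carrier ⊕ U.carrier, inferInstance⟩, ⟨Sum.inl, Sum.inl_injective⟩, ⟨q, qinj⟩, ?_⟩
  apply Function.Embedding.ext
  intro x
  exact (hq x).symm

end FI

/-- The category of `FI`-modules: functors from `FI` to `R`-modules. The case `R = ℤ` gives
functors to abelian groups. -/
abbrev FIMod (R : Type) [CommRing R] : Type (u + 1) := FI.{u} ⥤ ModuleCat.{u} R

namespace FIMod

section

variable {R : Type} [CommRing R]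

/-! ### The category of `FI`-modules has enough projectives and enough injectives -/

/-- The finite sets `{0, …, n - 1}`, as a family of objects of `FI`. -/
def std : Discrete (ULift.{u} ℕ) ⥤ FI.{u} :=
  Discrete.functor fun n => ⟨ULift.{u} (Fin n.down), inferInstance⟩

lemma exists_iso_std (S : FI.{u}) : ∃ n, Nonempty (std.obj n ≅ S) := by
  have := S.finite
  let e : S.carrier ≃ ULift.{u} (Fin (Nat.card S.carrier)) :=
    (Finite.equivFin S.carrier).trans Equiv.ulift.symm
  refine ⟨⟨⟨Nat.card S.carrier⟩⟩, ⟨⟨e.symm.toEmbedding, e.toEmbedding, ?_, ?_⟩⟩⟩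
  · apply Function.Embedding.ext
    intro x
    exact e.apply_symm_apply x
  · apply Function.Embedding.ext
    intro x
    exact e.symm_apply_apply x

variable (R) in
/-- Restriction of `FI`-modules to the objects `{0, …, n - 1}`. -/
abbrev res : FIMod.{u} R ⥤ (Discrete (ULift.{u} ℕ) ⥤ ModuleCat.{u} R) :=
  (Functor.whiskeringLeft _ _ _).obj std

instance : (res.{u} R).Faithful where
  map_injective {V W f g} h := by
    ext1
    funext S
    obtain ⟨n, ⟨e⟩⟩ := exists_iso_std S
    have hn : f.app (std.obj n) = g.app (std.obj n) := congr_arg (fun t => t.app n) h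
    rw [← cancel_epi (V.map e.hom), f.naturality, g.naturality, hn]

instance {ι : Type u} : EnoughInjectives (Discrete ι ⥤ ModuleCat.{u} R) where
  presentation X := by
    refine ⟨⟨Discrete.functor fun i => Injective.under (X.obj ⟨i⟩), ⟨?_⟩,
      Discrete.natTrans fun i => Injective.ι (X.obj i), ?_⟩⟩
    · intro Y Z g f hf
      have hf' : ∀ i, Mono (f.app i) := fun i => inferInstance
      refine ⟨Discrete.natTrans fun i =>
        (Injective.factorThru (J := Injective.under (X.obj ⟨i.as⟩)) (g.app i) (f.app i)), ?_⟩
      ext1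
      funext i
      exact Injective.comp_factorThru (J := Injective.under (X.obj ⟨i.as⟩)) _ _
    · have : ∀ i, Mono ((Discrete.natTrans (F := X)
          (G := Discrete.functor fun i => Injective.under (X.obj ⟨i⟩))
          fun i => Injective.ι (X.obj i)).app i) := fun i =>
        inferInstanceAs (Mono (Injective.ι (X.obj i)))
      exact NatTrans.mono_of_mono_app _

instance {ι : Type u} : EnoughProjectives (Discrete ι ⥤ ModuleCat.{u} R) where
  presentation X := by
    refine ⟨{ p := Discrete.functor fun i => Projective.over (X.obj ⟨i⟩)
              f := Discrete.natTrans fun i => Projective.π (X.obj i)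
              projective := ⟨?_⟩
              epi := ?_ }⟩
    · intro Y Z g f hf
      have hf' : ∀ i, Epi (f.app i) := fun i => inferInstance
      refine ⟨Discrete.natTrans fun i =>
        (Projective.factorThru (P := Projective.over (X.obj ⟨i.as⟩)) (g.app i) (f.app i)), ?_⟩
      ext1
      funext i
      exact Projective.factorThru_comp (P := Projective.over (X.obj ⟨i.as⟩)) _ _
    · have : ∀ i, Epi ((Discrete.natTrans
          (F := Discrete.functor fun i => Projective.over (X.obj ⟨i⟩)) (G := X)
          fun i => Projective.π (X.obj i)).app i) := fun i =>
        inferInstanceAs (Epi (Projective.π (X.obj i)))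
      exact NatTrans.epi_of_epi_app _

instance : EnoughInjectives (FIMod.{u} R) :=
  EnoughInjectives.of_adjunction (std.{u}.ranAdjunction (ModuleCat.{u} R))

instance : EnoughProjectives (FIMod.{u} R) where
  presentation V := by
    let adj := std.{u}.lanAdjunction (ModuleCat.{u} R)
    let P := Projective.over ((res.{u} R).obj V)
    have hP : Projective (std.{u}.lan.obj P) := adj.map_projective P inferInstance
    let q : std.{u}.lan.obj P ⟶ V := std.{u}.lan.map (Projective.π ((res.{u} R).obj V)) ≫ adj.counit.app V
    have : Epi (std.{u}.lan.map (Projective.π ((res.{u} R).obj V))) :=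
      have := adj.isLeftAdjoint
      inferInstance
    have : Epi (adj.counit.app V) := inferInstance
    exact ⟨{ p := _, f := q, projective := hP, epi := epi_comp _ _ }⟩

/-! ### Degree -/

/-- The least `d ≥ -1` (possibly `∞`) such that `W` vanishes on all finite sets with more than
`d` elements. -/
noncomputable def deg (W : FIMod.{u} R) : WithTop ℤ :=
  sInf {d : WithTop ℤ | -1 ≤ d ∧
    ∀ S : FI.{u}, d < (Nat.card S.carrier : WithTop ℤ) → IsZero (W.obj S)}

/-! ### `FI`-homology -/

/-- The image of `⨁_{A ⊊ S} V_A → V_S`. -/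
def fromProper (V : FIMod.{u} R) (S : FI.{u}) : Submodule R (V.obj S) :=
  ⨆ (A : Set S.carrier) (_ : A ≠ Set.univ), LinearMap.range (V.map (FI.incl A)).hom

lemma fromProper_le_comap (V : FIMod.{u} R) {S T : FI.{u}} (f : S ⟶ T) :
    fromProper V S ≤ (fromProper V T).comap (V.map f).hom := by
  refine iSup₂_le fun A hA => ?_
  let f' : S.carrier ↪ T.carrier := f
  let B : Set T.carrier := f' '' A
  have hB : B ≠ Set.univ := by
    intro h
    apply hA
    ext x
    simp only [Set.mem_univ, iff_true]
    have hx : f' x ∈ B := h ▸ Set.mem_univ _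
    obtain ⟨y, hy, hxy⟩ := hx
    exact f'.injective hxy ▸ hy
  let g : FI.sub A ⟶ FI.sub B :=
    (⟨fun x => ⟨f' x.1, x.1, x.2, rfl⟩, fun x y h =>
      Subtype.ext (f'.injective (congr_arg Subtype.val h))⟩ : A ↪ B)
  have hfg : FI.incl A ≫ f = g ≫ FI.incl B := by
    apply Function.Embedding.ext
    intro x
    rfl
  rintro _ ⟨x, rfl⟩
  have h1 : (V.map f).hom ((V.map (FI.incl A)).hom x) =
      (V.map (FI.incl B)).hom ((V.map g).hom x) := by
    rw [← LinearMap.comp_apply, ← LinearMap.comp_apply, ← ModuleCat.hom_comp,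
      ← ModuleCat.hom_comp, ← V.map_comp, ← V.map_comp, hfg]
  rw [Submodule.mem_comap, h1]
  exact le_iSup₂ (f := fun (A : Set T.carrier) (_ : A ≠ Set.univ) =>
    LinearMap.range (V.map (FI.incl A)).hom) B hB ⟨_, rfl⟩

lemma fromProper_le_comap_app {V W : FIMod.{u} R} (φ : V ⟶ W) (S : FI.{u}) :
    fromProper V S ≤ (fromProper W S).comap (φ.app S).hom := by
  refine iSup₂_le fun A hA => ?_
  rintro _ ⟨x, rfl⟩
  have h1 : (φ.app S).hom ((V.map (FI.incl A)).hom x) =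
      (W.map (FI.incl A)).hom ((φ.app _).hom x) := by
    rw [← LinearMap.comp_apply, ← LinearMap.comp_apply, ← ModuleCat.hom_comp,
      ← ModuleCat.hom_comp, φ.naturality]
  rw [Submodule.mem_comap, h1]
  exact le_iSup₂ (f := fun (A : Set S.carrier) (_ : A ≠ Set.univ) =>
    LinearMap.range (W.map (FI.incl A)).hom) A hA ⟨_, rfl⟩

/-- The functor `V ↦ (S ↦ coker (⨁_{A ⊊ S} V_A → V_S))`. -/
def homologyZero (R : Type) [CommRing R] : FIMod.{u} R ⥤ FIMod.{u} R where
  obj V :=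
    { obj := fun S => ModuleCat.of R (V.obj S ⧸ fromProper V S)
      map := fun f => ModuleCat.ofHom (Submodule.mapQ _ _ (V.map f).hom (fromProper_le_comap V f))
      map_id := fun S => by
        ext x
        simp
      map_comp := fun f g => by
        ext x
        simp }
  map φ :=
    { app := fun S => ModuleCat.ofHom
        (Submodule.mapQ _ _ (φ.app S).hom (fromProper_le_comap_app φ S))
      naturality := fun S T f => by
        ext x
        have h := congr_arg (fun t => t.hom x) (φ.naturality f)
        simp only [ModuleCat.hom_comp, LinearMap.comp_apply] at h
        simp [h] }
  map_id V := by
    ext S x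
    simp
  map_comp φ ψ := by
    ext S x
    simp

instance : (homologyZero.{u} R).Additive where
  map_add {V W φ ψ} := by
    ext S x
    obtain ⟨x, rfl⟩ := Submodule.mkQ_surjective _ x
    rfl

/-- `FI`-homology: the left derived functors of `homologyZero`. -/
noncomputable def homology (R : Type) [CommRing R] (i : ℕ) : FIMod.{u} R ⥤ FIMod.{u} R := (homologyZero R).leftDerived i

/-- `t_i(V)`, the degree of the `i`-th `FI`-homology. -/
noncomputable def t (i : ℕ) (V : FIMod.{u} R) : WithTop ℤ := deg ((homology R i).obj V)

/-- `V` is presented in finite degrees: `t_0(V)` and `t_1(V)` are finite. -/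
def PresentedInFiniteDegrees (V : FIMod.{u} R) : Prop := t 0 V ≠ ⊤ ∧ t 1 V ≠ ⊤

/-! ### Shift, derivative, and derived iterated derivatives -/

/-- The shift functor: precomposition with `S ↦ S ⊔ {*}`. -/
abbrev shift (R : Type) [CommRing R] : FIMod.{u} R ⥤ FIMod.{u} R := (Functor.whiskeringLeft _ _ _).obj FI.addPoint

/-- The natural transformation from the identity to the shift induced by `S ⊆ S ⊔ {*}`. -/
def toShift (R : Type) [CommRing R] : 𝟭 (FIMod.{u} R) ⟶ shift R where
  app V := { app := fun S => V.map (FI.inclPoint.app S)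
             naturality := fun S T f => by
               change V.map f ≫ V.map _ = V.map _ ≫ V.map (FI.addPoint.map f)
               rw [← V.map_comp, ← V.map_comp]
               exact congr_arg V.map (FI.inclPoint.naturality f) }
  naturality V W φ := by
    ext1
    funext S
    exact (φ.naturality (FI.inclPoint.app S)).symm

/-- The derivative functor: the cokernel of `toShift`. -/
noncomputable def derivative (R : Type) [CommRing R] : FIMod.{u} R ⥤ FIMod.{u} R where
  obj V := cokernel ((toShift R).app V)
  map {V W} φ := cokernel.map ((toShift R).app V) ((toShift R).app W) φ ((shift R).map φ)
    ((toShift R).naturality φ).symm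
  map_id V := by
    rw [← cancel_epi (cokernel.π ((toShift R).app V))]
    simp
  map_comp {V W X} φ ψ := by
    refine (cancel_epi (cokernel.π ((toShift R).app V))).1 ?_
    simp

instance : (derivative.{u} R).Additive where
  map_add {V W φ ψ} := by
    refine (cancel_epi (cokernel.π ((toShift R).app V))).1 ?_
    have e (χ : V ⟶ W) : cokernel.π ((toShift R).app V) ≫ (derivative.{u} R).map χ =
        (shift R).map χ ≫ cokernel.π ((toShift R).app W) := cokernel.π_desc _ _ _
    refine (e (φ + ψ)).trans ?_
    refine Eq.trans ?_ (Preadditive.comp_add _ _ _ _ _ _).symm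
    rw [e φ, e ψ]
    exact Preadditive.add_comp _ _ _ ((shift R).map φ) ((shift R).map ψ) _

/-- The `a`-fold composite of the derivative functor. -/
noncomputable def iterDerivative (R : Type) [CommRing R] : ℕ → (FIMod.{u} R ⥤ FIMod.{u} R)
  | 0 => 𝟭 _
  | a + 1 => iterDerivative R a ⋙ derivative R

instance iterDerivative_additive : ∀ a : ℕ, (iterDerivative.{u} R a).Additive
  | 0 => inferInstanceAs (𝟭 (FIMod.{u} R)).Additive
  | a + 1 =>
    have := iterDerivative_additive a
    inferInstanceAs (iterDerivative.{u} R a ⋙ derivative R).Additive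

/-- The `i`-th left derived functor of the `a`-fold derivative. -/
noncomputable def derivedDerivative (R : Type) [CommRing R] (a i : ℕ) : FIMod.{u} R ⥤ FIMod.{u} R :=
  (iterDerivative R a).leftDerived i

/-! ### Torsion and local cohomology -/

/-- The elements of `V_S` killed by some injection `S ↪ T`. -/
def torsionAt (V : FIMod.{u} R) (S : FI.{u}) : Submodule R (V.obj S) where
  carrier := {x | ∃ (T : FI.{u}) (α : S ⟶ T), (V.map α).hom x = 0}
  zero_mem' := ⟨S, 𝟙 S, map_zero _⟩
  add_mem' := by
    rintro x y ⟨T, α, hx⟩ ⟨U, β, hy⟩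
    obtain ⟨W, p, q, h⟩ := FI.exists_square α β
    refine ⟨W, α ≫ p, ?_⟩
    rw [map_add]
    nth_rewrite 2 [h]
    simp [hx, hy]
  smul_mem' := by
    rintro c x ⟨T, α, hx⟩
    exact ⟨T, α, by rw [map_smul, hx, smul_zero]⟩

lemma torsionAt_map (V : FIMod.{u} R) {S T : FI.{u}} (f : S ⟶ T) :
    ∀ x ∈ torsionAt V S, (V.map f).hom x ∈ torsionAt V T := by
  rintro x ⟨U, α, hx⟩
  obtain ⟨W, p, q, h⟩ := FI.exists_square f α
  refine ⟨W, p, ?_⟩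
  rw [← LinearMap.comp_apply, ← ModuleCat.hom_comp, ← V.map_comp, h]
  simp [hx]

lemma torsionAt_app {V W : FIMod.{u} R} (φ : V ⟶ W) (S : FI.{u}) :
    ∀ x ∈ torsionAt V S, (φ.app S).hom x ∈ torsionAt W S := by
  rintro x ⟨T, α, hx⟩
  refine ⟨T, α, ?_⟩
  rw [← LinearMap.comp_apply, ← ModuleCat.hom_comp, ← φ.naturality, ModuleCat.hom_comp,
    LinearMap.comp_apply, hx, map_zero]

/-- The functor sending an `FI`-module to its largest torsion submodule. -/
def torsion (R : Type) [CommRing R] : FIMod.{u} R ⥤ FIMod.{u} R where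
  obj V :=
    { obj := fun S => ModuleCat.of R (torsionAt V S)
      map := fun f => ModuleCat.ofHom ((V.map f).hom.restrict (torsionAt_map V f))
      map_id := fun S => by
        ext x
        simp [LinearMap.restrict_apply]
      map_comp := fun f g => by
        ext x
        simp [LinearMap.restrict_apply] }
  map φ :=
    { app := fun S => ModuleCat.ofHom ((φ.app S).hom.restrict (torsionAt_app φ S))
      naturality := fun S T f => by
        ext x
        have h := congr_arg (fun t => t.hom x.1) (φ.naturality f)
        simp only [ModuleCat.hom_comp, LinearMap.comp_apply] at h
        simp [LinearMap.restrict_apply, h] }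
  map_id V := by
    ext S x
    simp [LinearMap.restrict_apply]
  map_comp φ ψ := by
    ext S x
    simp [LinearMap.restrict_apply]

instance : (torsion.{u} R).Additive where
  map_add {V W φ ψ} := by
    ext S x
    rfl

/-- Local cohomology: the right derived functors of `torsion`. -/
noncomputable def localCohomology (R : Type) [CommRing R] (j : ℕ) : FIMod.{u} R ⥤ FIMod.{u} R := (torsion R).rightDerived j

/-- `h^j(V)`, the degree of the `j`-th local cohomology. -/
noncomputable def h (j : ℕ) (V : FIMod.{u} R) : WithTop ℤ := deg ((localCohomology R j).obj V)

end

end FIMod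

/-! Both inequalities follow from pointwise non-vanishing statements. If `H^m(Δ^a V)` is nonzero at
`S`, then for some `j ≤ m + a` and some `T` the module `H^j(V)` is nonzero at `T` and `|S| + m + a ≤
|T| + j`. If `L_i Δ^a V` with `i ≥ 1` is nonzero at `S`, then the same holds for some `j ≤ a - i`
with `|S| + a ≤ |T| + j + i`. Both go by induction on `a`, adding one derivative at a time.

For local cohomology, let `K` and `I` be the kernel and image of `V → ΣV`. The sequences `0 → K → V
→ I → 0` and `0 → I → ΣV → ΔV → 0` show that `H^j(ΔV)_S` vanishes as soon as `H^j(V)` vanishes at `S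
⊔ {*}` and `H^{j+1}(V)` vanishes at `S`, provided `K` has no higher local cohomology
(`LCVanishes.derivative`). Passing to `S ⊔ {*}` or to `j + 1` raises `|S| + j` by exactly one. The
shift is exact, preserves injectives and commutes with torsion, so its local cohomology at `S` is
that of `V` at `S ⊔ {*}`. A module vanishing on large sets embeds in an injective of the same kind,
so its higher local cohomology is zero.

The finiteness hypothesis serves to show that `K` vanishes on large sets, also for every `Δ^a V` in
place of `V`. This is a coherence argument (`finPres_of_genBelow`) for `0 → N → P → V → 0` with `P`
generated in finite degrees and `P → ΣP` split: the snake lemma embeds `K` in `ΔN` with quotient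
inside `ΔP`, and `ΔP` is generated in lower degrees. No Noetherian hypothesis on the ring enters.

For derived derivatives, a projective presentation reduces `L_i Δ^{a+1}` at `S` to `L_i Δ^a` at `S ⊔
{*}` together with `L_{i-1} Δ^a` at `S`. When `i = 1` the second term is replaced by the kernel of
`Δ^a V → ΣΔ^a V`, which is torsion, and the first inequality with `m = 0` applies. -/

namespace CategoryTheory

/-! ### Dimension shifting for derived functors, via spliced resolutions -/

section

universe v₁ v₂ u₁ u₂
variable {C : Type u₁} [Category.{v₁} C] [Abelian C] {D : Type u₂} [Category.{v₂} D] [Abelian D]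

lemma exact_comp_left_iff_epi {S : ShortComplex C} {A : C} (p : A ⟶ S.X₁) (hS : S.Exact)
    [Mono S.f] : (ShortComplex.mk (p ≫ S.f) S.g (by simp)).Exact ↔ Epi p := by
  rw [ShortComplex.exact_iff_exact_up_to_refinements, epi_iff_surjective_up_to_refinements]
  refine ⟨fun h T x => ?_, fun h T x hx => ?_⟩
  · obtain ⟨T', π, hπ, y, hy⟩ := h (x ≫ S.f) (by simp)
    refine ⟨T', π, hπ, y, ?_⟩
    rw [← cancel_mono S.f]
    simpa using hy
  · obtain ⟨T', π, hπ, y, hy⟩ := h (hS.lift x hx)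
    refine ⟨T', π, hπ, y, ?_⟩
    simpa using congr_arg (· ≫ S.f) hy

lemma exact_comp_right_iff_mono {S : ShortComplex C} {A : C} (i : S.X₃ ⟶ A) (hS : S.Exact)
    [Epi S.g] : (ShortComplex.mk S.f (S.g ≫ i) (by simp)).Exact ↔ Mono i := by
  constructor
  · intro h
    refine Preadditive.mono_of_cancel_zero _ fun {T} x hx => ?_
    obtain ⟨T', π, hπ, y, hy⟩ := surjective_up_to_refinements_of_epi S.g x
    obtain ⟨T'', π', hπ', z, hz⟩ := h.exact_up_to_refinements y (by
      dsimp
      rw [← Category.assoc, ← hy, Category.assoc, hx, comp_zero])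
    rw [← cancel_epi π, ← cancel_epi π', hy]
    dsimp at hz
    rw [reassoc_of% hz, S.zero]
    simp
  · intro h
    let α : S ⟶ ShortComplex.mk S.f (S.g ≫ i) (by simp) :=
      { τ₁ := 𝟙 _
        τ₂ := 𝟙 _
        τ₃ := i }
    have : Epi α.τ₁ := inferInstanceAs (Epi (𝟙 _))
    have : IsIso α.τ₂ := inferInstanceAs (IsIso (𝟙 _))
    have : Mono α.τ₃ := h
    exact (ShortComplex.exact_iff_of_epi_of_isIso_of_mono α).1 hS

namespace InjectiveResolution

/-- The augmentation of an injective resolution, as a morphism from the resolved object. -/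
def aug {Z : C} (J : InjectiveResolution Z) : Z ⟶ J.cocomplex.X 0 := J.ι.f 0

lemma aug_d {Z : C} (J : InjectiveResolution Z) : J.aug ≫ J.cocomplex.d 0 1 = 0 :=
  J.ι_f_zero_comp_complex_d

instance {Z : C} (J : InjectiveResolution Z) : Mono J.aug := inferInstanceAs (Mono (J.ι.f 0))

lemma exact_aug {Z : C} (J : InjectiveResolution Z) : (ShortComplex.mk _ _ J.aug_d).Exact :=
  J.exact₀

/-- An injective resolution of the cokernel of a monomorphism into an injective object gives an
injective resolution of the source. -/
noncomputable def splice {S : ShortComplex C} (hS : S.ShortExact)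
    (hI : Injective S.X₂) (J : InjectiveResolution S.X₃) : InjectiveResolution S.X₁ where
  cocomplex := J.cocomplex.augment (S.g ≫ J.aug) (by
    rw [Category.assoc, J.aug_d, comp_zero])
  injective n := by
    cases n with
    | zero => exact hI
    | succ n => exact J.injective n
  ι := (CochainComplex.fromSingle₀Equiv _ _).symm ⟨S.f, by
    change S.f ≫ (S.g ≫ J.aug) = 0
    rw [S.zero_assoc, zero_comp]⟩
  quasiIso := ⟨fun n => by
    have := hS.mono_f
    have := hS.epi_g
    match n with
    | 0 =>
      rw [CochainComplex.quasiIsoAt₀_iff, ShortComplex.quasiIso_iff_of_zeros]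
      · refine (ShortComplex.exact_and_mono_f_iff_of_iso
          (S₂ := ShortComplex.mk S.f (S.g ≫ J.aug) (by rw [S.zero_assoc, zero_comp])) ?_).2
          ⟨?_, hS.mono_f⟩
        · exact ShortComplex.isoMk (Iso.refl _) (Iso.refl _) (Iso.refl _)
            (by
              refine (Category.id_comp S.f).trans (Eq.trans ?_ (Category.comp_id _).symm)
              exact (CochainComplex.fromSingle₀Equiv_symm_apply_f_zero
                (C := J.cocomplex.augment (S.g ≫ J.aug) _) S.f _).symm)
            ((Category.id_comp (S.g ≫ J.aug)).trans (Category.comp_id _).symm)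
        · let α : S ⟶ ShortComplex.mk S.f (S.g ≫ J.aug) (by rw [S.zero_assoc, zero_comp]) :=
            { τ₁ := 𝟙 _
              τ₂ := 𝟙 _
              τ₃ := J.aug }
          have : Mono α.τ₃ := inferInstanceAs (Mono J.aug)
          have : Epi α.τ₁ := inferInstanceAs (Epi (𝟙 _))
          have : IsIso α.τ₂ := inferInstanceAs (IsIso (𝟙 _))
          exact (ShortComplex.exact_iff_of_epi_of_isIso_of_mono α).1 hS.exact
      all_goals rfl
    | 1 =>
      rw [quasiIsoAt_iff_exactAt _ _ (CochainComplex.exactAt_succ_single_obj _ _)]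
      rw [HomologicalComplex.exactAt_iff' _ 0 1 2 (by simp) (by simp)]
      let α : ShortComplex.mk (S.g ≫ J.aug) (J.cocomplex.d 0 1)
          (by rw [Category.assoc, J.aug_d, comp_zero]) ⟶
          ShortComplex.mk _ _ J.aug_d :=
        { τ₁ := S.g
          τ₂ := 𝟙 _
          τ₃ := 𝟙 _ }
      have : Epi α.τ₁ := hS.epi_g
      have : IsIso α.τ₂ := inferInstanceAs (IsIso (𝟙 _))
      have : Mono α.τ₃ := inferInstanceAs (Mono (𝟙 _))
      exact (ShortComplex.exact_iff_of_epi_of_isIso_of_mono α).2 J.exact_aug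
    | n + 2 =>
      rw [quasiIsoAt_iff_exactAt _ _ (CochainComplex.exactAt_succ_single_obj _ _)]
      rw [HomologicalComplex.exactAt_iff' _ (n + 1) (n + 2) (n + 3) (by simp) (by simp)]
      exact J.exact_succ n⟩

end InjectiveResolution

section

variable [HasInjectiveResolutions C] (F : C ⥤ D) [F.Additive]

lemma InjectiveResolution.isZero_rightDerived_obj_succ_iff {X : C} (P : InjectiveResolution X)
    (n : ℕ) : IsZero ((F.rightDerived (n + 1)).obj X) ↔
      (ShortComplex.mk (F.map (P.cocomplex.d n (n + 1))) (F.map (P.cocomplex.d (n + 1) (n + 2)))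
        (by rw [← F.map_comp, P.complex_d_comp, F.map_zero])).Exact := by
  rw [(P.isoRightDerivedObj F (n + 1)).isZero_iff]
  change IsZero (HomologicalComplex.homology _ _) ↔ _
  rw [← HomologicalComplex.exactAt_iff_isZero_homology,
    HomologicalComplex.exactAt_iff' _ n (n + 1) (n + 2) (by simp) (by simp)]
  rfl

/-- Splicing moves a resolution of `S.X₃` up by one place, so both sides are exactness of the same
short complex. -/
lemma ShortComplex.ShortExact.isZero_rightDerived_iff {S : ShortComplex C} (hS : S.ShortExact)
    (hI : Injective S.X₂) (n : ℕ) :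
    IsZero ((F.rightDerived (n + 2)).obj S.X₁) ↔ IsZero ((F.rightDerived (n + 1)).obj S.X₃) := by
  let J := injectiveResolution S.X₃
  rw [J.isZero_rightDerived_obj_succ_iff F n,
    (InjectiveResolution.splice hS hI J).isZero_rightDerived_obj_succ_iff F (n + 1)]
  rfl

/-- Left exactness identifies `F S.X₃` with the kernel of `F J⁰ → F J¹`, so exactness of the spliced
complex in degree one says that `F S.X₂` surjects onto `F S.X₃`. -/
lemma ShortComplex.ShortExact.isZero_rightDerived_one_iff [PreservesFiniteLimits F]
    {S : ShortComplex C} (hS : S.ShortExact) (hI : Injective S.X₂) :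
    IsZero ((F.rightDerived 1).obj S.X₁) ↔ Epi (F.map S.g) := by
  let J := injectiveResolution S.X₃
  rw [(InjectiveResolution.splice hS hI J).isZero_rightDerived_obj_succ_iff F 0]
  have h := ((F.preservesFiniteLimits_tfae.out 3 1 :).1 inferInstance) _
    ⟨J.exact_aug, inferInstanceAs (Mono J.aug)⟩
  have : Mono ((ShortComplex.mk _ _ J.aug_d).map F).f := h.2
  refine Iff.trans (Eq.to_iff (congrArg ShortComplex.Exact ?_))
    (exact_comp_left_iff_epi (S := (ShortComplex.mk _ _ J.aug_d).map F) (F.map S.g) h.1)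
  congr 1
  exact F.map_comp _ _

end

namespace ProjectiveResolution

/-- The augmentation of a projective resolution, as a morphism to the resolved object. -/
def aug {Z : C} (P : ProjectiveResolution Z) : P.complex.X 0 ⟶ Z := P.π.f 0

lemma d_aug {Z : C} (P : ProjectiveResolution Z) : P.complex.d 1 0 ≫ P.aug = 0 :=
  P.complex_d_comp_π_f_zero

instance {Z : C} (P : ProjectiveResolution Z) : Epi P.aug := inferInstanceAs (Epi (P.π.f 0))

lemma exact_aug {Z : C} (P : ProjectiveResolution Z) : (ShortComplex.mk _ _ P.d_aug).Exact :=
  P.exact₀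

/-- A projective resolution of the kernel of an epimorphism from a projective object gives a
projective resolution of the target. -/
noncomputable def splice {S : ShortComplex C} (hS : S.ShortExact)
    (hQ : Projective S.X₂) (P : ProjectiveResolution S.X₁) : ProjectiveResolution S.X₃ where
  complex := P.complex.augment (P.aug ≫ S.f) (by
    rw [← Category.assoc, P.d_aug, zero_comp])
  projective n := by
    cases n with
    | zero => exact hQ
    | succ n => exact P.projective n
  π := (ChainComplex.toSingle₀Equiv _ _).symm ⟨S.g, by
    change (P.aug ≫ S.f) ≫ S.g = 0
    rw [Category.assoc, S.zero, comp_zero]⟩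
  quasiIso := ⟨fun n => by
    have := hS.mono_f
    have := hS.epi_g
    match n with
    | 0 =>
      rw [ChainComplex.quasiIsoAt₀_iff, ShortComplex.quasiIso_iff_of_zeros']
      · refine (ShortComplex.exact_and_epi_g_iff_of_iso
          (S₂ := ShortComplex.mk (P.aug ≫ S.f) S.g
            (by rw [Category.assoc, S.zero, comp_zero])) ?_).2 ⟨?_, hS.epi_g⟩
        · exact ShortComplex.isoMk (Iso.refl _) (Iso.refl _) (Iso.refl _)
            ((Category.id_comp (P.aug ≫ S.f)).trans (Category.comp_id _).symm)
            (by
              refine (Category.id_comp S.g).trans (Eq.trans ?_ (Category.comp_id _).symm)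
              exact (ChainComplex.toSingle₀Equiv_symm_apply_f_zero
                (C := P.complex.augment (P.aug ≫ S.f) _) S.g _).symm)
        · let α : ShortComplex.mk (P.aug ≫ S.f) S.g
              (by rw [Category.assoc, S.zero, comp_zero]) ⟶ S :=
            { τ₁ := P.aug
              τ₂ := 𝟙 _
              τ₃ := 𝟙 _ }
          have : Epi α.τ₁ := inferInstanceAs (Epi P.aug)
          have : IsIso α.τ₂ := inferInstanceAs (IsIso (𝟙 _))
          have : Mono α.τ₃ := inferInstanceAs (Mono (𝟙 _))
          exact (ShortComplex.exact_iff_of_epi_of_isIso_of_mono α).2 hS.exact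
      all_goals rfl
    | 1 =>
      rw [quasiIsoAt_iff_exactAt' _ _ (ChainComplex.exactAt_succ_single_obj _ _)]
      rw [HomologicalComplex.exactAt_iff' _ 2 1 0 (by simp) (by simp)]
      exact (exact_comp_right_iff_mono S.f P.exact_aug).2 hS.mono_f
    | n + 2 =>
      rw [quasiIsoAt_iff_exactAt' _ _ (ChainComplex.exactAt_succ_single_obj _ _)]
      rw [HomologicalComplex.exactAt_iff' _ (n + 3) (n + 2) (n + 1) (by simp) (by simp)]
      exact P.exact_succ n⟩

end ProjectiveResolution

section

variable [HasProjectiveResolutions C] (F : C ⥤ D) [F.Additive]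

lemma ProjectiveResolution.isZero_leftDerived_obj_succ_iff {X : C} (P : ProjectiveResolution X)
    (n : ℕ) : IsZero ((F.leftDerived (n + 1)).obj X) ↔
      (ShortComplex.mk (F.map (P.complex.d (n + 2) (n + 1))) (F.map (P.complex.d (n + 1) n))
        (by rw [← F.map_comp, P.complex.d_comp_d, F.map_zero])).Exact := by
  rw [(P.isoLeftDerivedObj F (n + 1)).isZero_iff]
  change IsZero (HomologicalComplex.homology _ _) ↔ _
  rw [← HomologicalComplex.exactAt_iff_isZero_homology,
    HomologicalComplex.exactAt_iff' _ (n + 2) (n + 1) n (by simp) (by simp)]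
  rfl

lemma ShortComplex.ShortExact.isZero_leftDerived_iff {S : ShortComplex C} (hS : S.ShortExact)
    (hQ : Projective S.X₂) (n : ℕ) :
    IsZero ((F.leftDerived (n + 2)).obj S.X₃) ↔ IsZero ((F.leftDerived (n + 1)).obj S.X₁) := by
  let P := projectiveResolution S.X₁
  rw [P.isZero_leftDerived_obj_succ_iff F n,
    (ProjectiveResolution.splice hS hQ P).isZero_leftDerived_obj_succ_iff F (n + 1)]
  rfl

lemma ShortComplex.ShortExact.isZero_leftDerived_one_iff [PreservesFiniteColimits F]
    {S : ShortComplex C} (hS : S.ShortExact) (hQ : Projective S.X₂) :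
    IsZero ((F.leftDerived 1).obj S.X₃) ↔ Mono (F.map S.f) := by
  let P := projectiveResolution S.X₁
  rw [(ProjectiveResolution.splice hS hQ P).isZero_leftDerived_obj_succ_iff F 0]
  have h := ((F.preservesFiniteColimits_tfae.out 3 1 :).1 inferInstance) _
    ⟨P.exact_aug, inferInstanceAs (Epi P.aug)⟩
  have : Epi ((ShortComplex.mk _ _ P.d_aug).map F).g := h.2
  refine Iff.trans (Eq.to_iff (congrArg ShortComplex.Exact ?_))
    (exact_comp_right_iff_mono (S := (ShortComplex.mk _ _ P.d_aug).map F) (F.map S.f) h.1)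
  congr 1
  exact F.map_comp _ _

end

end
end CategoryTheory

/-! ### Consequences of the long exact sequence, stated as vanishing criteria -/

namespace CategoryTheory

section

universe v₁ v₂ u₁ u₂
variable {C : Type u₁} [Category.{v₁} C] [Abelian C] {D : Type u₂} [Category.{v₂} D] [Abelian D]

namespace ShortComplex.ShortExact

variable {S : ShortComplex C} (F : C ⥤ D) [F.Additive] [PreservesFiniteLimits F]

lemma exact_map_and_mono (hS : S.ShortExact) : (S.map F).Exact ∧ Mono (F.map S.f) :=
  ((F.preservesFiniteLimits_tfae.out 3 0 :).1 inferInstance) S hS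

variable [EnoughInjectives C]

/-- The exact sequence of quotients attached to `A ⊆ B ⊆ I` with `I` injective. -/
lemma exists_injective_diagram (hS : S.ShortExact) :
    ∃ (I QA QB : C) (i : S.X₂ ⟶ I) (pA : I ⟶ QA) (pB : I ⟶ QB)
    (c : S.X₃ ⟶ QA) (q : QA ⟶ QB) (wA : (S.f ≫ i) ≫ pA = 0) (wB : i ≫ pB = 0) (wQ : c ≫ q = 0),
    Injective I ∧ (ShortComplex.mk (S.f ≫ i) pA wA).ShortExact ∧
    (ShortComplex.mk i pB wB).ShortExact ∧ (ShortComplex.mk c q wQ).ShortExact ∧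
    i ≫ pA = S.g ≫ c ∧ pA ≫ q = pB := by
  have := hS.mono_f
  have := hS.epi_g
  let i := Injective.ι S.X₂
  let pA := cokernel.π (S.f ≫ i)
  let pB := cokernel.π i
  let c : S.X₃ ⟶ cokernel (S.f ≫ i) := hS.exact.desc (i ≫ pA)
    (by rw [← Category.assoc]; exact cokernel.condition _)
  have hc : S.g ≫ c = i ≫ pA := hS.exact.g_desc _ _
  let q : cokernel (S.f ≫ i) ⟶ cokernel i := cokernel.desc _ pB
    (by rw [Category.assoc, cokernel.condition, comp_zero])
  have hq : pA ≫ q = pB := cokernel.π_desc _ _ _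
  have wA : (S.f ≫ i) ≫ pA = 0 := cokernel.condition _
  have wB : i ≫ pB = 0 := cokernel.condition _
  have wQ : c ≫ q = 0 := by
    rw [← cancel_epi S.g, reassoc_of% hc, hq, wB, comp_zero]
  have hA : (ShortComplex.mk (S.f ≫ i) pA wA).ShortExact :=
    { exact := ShortComplex.exact_cokernel _
      mono_f := inferInstanceAs (Mono (S.f ≫ i))
      epi_g := inferInstanceAs (Epi pA) }
  have hB : (ShortComplex.mk i pB wB).ShortExact :=
    { exact := ShortComplex.exact_cokernel _
      mono_f := inferInstanceAs (Mono i)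
      epi_g := inferInstanceAs (Epi pB) }
  refine ⟨_, _, _, i, pA, pB, c, q, wA, wB, wQ, inferInstance, hA, hB, ?_, hc.symm, hq⟩
  refine { exact := ?_, mono_f := ?_, epi_g := ?_ }
  · rw [ShortComplex.exact_iff_exact_up_to_refinements]
    intro T x hx
    dsimp at x hx
    obtain ⟨T', π, hπ, y, hy⟩ := surjective_up_to_refinements_of_epi pA x
    obtain ⟨z, hz⟩ := hB.exact.lift' y (by
      change y ≫ pB = 0
      rw [show y ≫ pB = y ≫ pA ≫ q by rw [hq], ← reassoc_of% hy, hx, comp_zero])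
    dsimp at hz
    refine ⟨T', π, hπ, z ≫ S.g, ?_⟩
    dsimp
    rw [hy, ← hz, Category.assoc, Category.assoc, hc]
  · refine Preadditive.mono_of_cancel_zero _ fun {T} x hx => ?_
    dsimp at x hx
    obtain ⟨T', π, hπ, y, hy⟩ := surjective_up_to_refinements_of_epi S.g x
    obtain ⟨z, hz⟩ := hA.exact.lift' (y ≫ i) (by
      dsimp
      rw [Category.assoc, ← hc, ← reassoc_of% hy, hx, comp_zero])
    dsimp at hz
    have hz' : z ≫ S.f = y := by
      rw [← cancel_mono i, Category.assoc, hz]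
    rw [← cancel_epi π, hy, ← hz', Category.assoc, S.zero, comp_zero, comp_zero]
  · have : Epi (pA ≫ q) := hq ▸ inferInstanceAs (Epi pB)
    exact epi_of_epi pA q

lemma epi_map_of_isZero (hS : S.ShortExact) (h : IsZero ((F.rightDerived 1).obj S.X₁)) : Epi (F.map S.g) := by
  obtain ⟨I, QA, QB, i, pA, pB, c, q, wA, wB, wQ, hI, hA, hB, hQ, h1, h2⟩ :=
    hS.exists_injective_diagram
  have := (hA.isZero_rightDerived_one_iff F hI).1 h
  obtain ⟨hBe, hBm⟩ := hB.exact_map_and_mono F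
  obtain ⟨hQe, hQm⟩ := hQ.exact_map_and_mono F
  dsimp at this hBe hBm hQe hQm
  rw [epi_iff_surjective_up_to_refinements]
  intro T z
  obtain ⟨T', π, hπ, y, hy⟩ := surjective_up_to_refinements_of_epi (F.map pA) (z ≫ F.map c)
  have : Mono (((ShortComplex.mk i pB wB).map F)).f := hBm
  obtain ⟨x, hx⟩ : ∃ x : T' ⟶ F.obj S.X₂, x ≫ F.map i = y := hBe.lift' y (by
    change y ≫ F.map pB = 0
    rw [← h2, F.map_comp, ← reassoc_of% hy, ← F.map_comp, wQ, F.map_zero, comp_zero, comp_zero])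
  refine ⟨T', π, hπ, x, ?_⟩
  rw [← cancel_mono (F.map c), Category.assoc, hy, ← hx, Category.assoc, Category.assoc,
    ← F.map_comp, ← F.map_comp, h1]

lemma isZero_rightDerived_one_X₁ (hS : S.ShortExact) (hg : Epi (F.map S.g))
    (h : IsZero ((F.rightDerived 1).obj S.X₂)) : IsZero ((F.rightDerived 1).obj S.X₁) := by
  obtain ⟨I, QA, QB, i, pA, pB, c, q, wA, wB, wQ, hI, hA, hB, hQ, h1, h2⟩ :=
    hS.exists_injective_diagram
  have := (hB.isZero_rightDerived_one_iff F hI).1 h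
  refine (hA.isZero_rightDerived_one_iff F hI).2 ?_
  obtain ⟨hQe, hQm⟩ := hQ.exact_map_and_mono F
  dsimp at this hQe hQm ⊢
  rw [epi_iff_surjective_up_to_refinements]
  intro T z
  obtain ⟨T', π, hπ, y, hy⟩ := surjective_up_to_refinements_of_epi (F.map pB) (z ≫ F.map q)
  have : Mono (((ShortComplex.mk c q wQ).map F)).f := hQm
  obtain ⟨w, hw⟩ : ∃ w : T' ⟶ F.obj S.X₃, w ≫ F.map c = π ≫ z - y ≫ F.map pA := hQe.lift' (π ≫ z - y ≫ F.map pA) (by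
    change (π ≫ z - y ≫ F.map pA) ≫ F.map q = 0
    rw [Preadditive.sub_comp, Category.assoc, Category.assoc, hy, ← F.map_comp, h2, sub_self])
  obtain ⟨T'', π', hπ', v, hv⟩ := surjective_up_to_refinements_of_epi (F.map S.g) w
  refine ⟨T'', π' ≫ π, inferInstance, π' ≫ y + v ≫ F.map i, ?_⟩
  have e : v ≫ F.map S.g ≫ F.map c = π' ≫ (π ≫ z - y ≫ F.map pA) := by
    rw [← hw, ← Category.assoc, ← hv, Category.assoc]
  rw [Preadditive.add_comp, Category.assoc, Category.assoc, Category.assoc, ← F.map_comp, h1,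
    F.map_comp, e, Preadditive.comp_sub]
  abel

/-- With `A ⊆ B ⊆ I`, the derived functors of `A` and `B` are those of `I/A` and `I/B` one degree
lower, and `0 → B/A → I/A → I/B → 0` is exact. Replacing the sequence by this one rotates the long
exact sequence, which drives the induction. -/
lemma isZero_rightDerived_succ_aux (n : ℕ) : ∀ {S : ShortComplex C}, S.ShortExact →
    (IsZero ((F.rightDerived (n + 1)).obj S.X₂) → IsZero ((F.rightDerived (n + 2)).obj S.X₁) →
      IsZero ((F.rightDerived (n + 1)).obj S.X₃)) ∧
    (IsZero ((F.rightDerived (n + 1)).obj S.X₁) → IsZero ((F.rightDerived (n + 1)).obj S.X₃) →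
      IsZero ((F.rightDerived (n + 1)).obj S.X₂)) := by
  induction n with
  | zero =>
    intro S hS
    obtain ⟨I, QA, QB, i, pA, pB, c, q, wA, wB, wQ, hI, hA, hB, hQ, h1, h2⟩ :=
      hS.exists_injective_diagram
    have eA := hA.isZero_rightDerived_one_iff F hI
    have eB := hB.isZero_rightDerived_one_iff F hI
    dsimp at eA eB
    constructor
    · intro hX2 hX1
      refine hQ.isZero_rightDerived_one_X₁ F ?_ ((hA.isZero_rightDerived_iff F hI 0).1 hX1)
      have := eB.1 hX2
      have : Epi (F.map pA ≫ F.map q) := by rwa [← F.map_comp, h2]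
      exact epi_of_epi (F.map pA) (F.map q)
    · intro hX1 hX3
      have := eA.1 hX1
      have : Epi (F.map q) := hQ.epi_map_of_isZero F hX3
      refine eB.2 ?_
      rw [← h2, F.map_comp]
      exact epi_comp _ _
  | succ n ih =>
    -- Exactness at the first term in degree `n + 2` is exactness at the middle term of the rotated
    -- sequence in degree `n + 1`.
    have h2 {S : ShortComplex C} (hS : S.ShortExact)
        (h3 : IsZero ((F.rightDerived (n + 1)).obj S.X₃))
        (h2 : IsZero ((F.rightDerived (n + 2)).obj S.X₂)) :
        IsZero ((F.rightDerived (n + 2)).obj S.X₁) := by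
      obtain ⟨I, QA, QB, i, pA, pB, c, q, wA, wB, wQ, hI, hA, hB, hQ, -, -⟩ :=
        hS.exists_injective_diagram
      exact (hA.isZero_rightDerived_iff F hI n).2
        ((ih hQ).2 h3 ((hB.isZero_rightDerived_iff F hI n).1 h2))
    intro S hS
    obtain ⟨I, QA, QB, i, pA, pB, c, q, wA, wB, wQ, hI, hA, hB, hQ, -, -⟩ :=
      hS.exists_injective_diagram
    constructor
    · intro hX2 hX1
      exact h2 hQ ((hB.isZero_rightDerived_iff F hI n).1 hX2)
        ((hA.isZero_rightDerived_iff F hI (n + 1)).1 hX1)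
    · intro hX1 hX3
      exact (hB.isZero_rightDerived_iff F hI n).2
        ((ih hQ).1 ((hA.isZero_rightDerived_iff F hI n).1 hX1) hX3)

/-- If `Rⁿ F` vanishes on the middle term of a short exact sequence and `Rⁿ⁺¹ F` vanishes on
the first one, then `Rⁿ F` vanishes on the last one. -/
lemma isZero_rightDerived_X₃ (hS : S.ShortExact) (n : ℕ)
    (h2 : IsZero ((F.rightDerived n).obj S.X₂))
    (h1 : IsZero ((F.rightDerived (n + 1)).obj S.X₁)) :
    IsZero ((F.rightDerived n).obj S.X₃) := by
  cases n with
  | zero =>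
    have := hS.epi_map_of_isZero F h1
    rw [(F.rightDerivedZeroIsoSelf.app _).isZero_iff] at h2 ⊢
    exact IsZero.of_epi (F.map S.g) h2
  | succ n => exact (isZero_rightDerived_succ_aux F n hS).1 h2 h1

end ShortComplex.ShortExact

variable {E : Type*} [Category* E] [Abelian E]

/-- Right derived functors commute with postcomposition by an exact functor. -/
noncomputable def Functor.rightDerivedCompObjIso [HasInjectiveResolutions C] (F : C ⥤ D)
    [F.Additive] (G : D ⥤ E) [G.Additive] [G.PreservesHomology] (n : ℕ) (X : C) :
    ((F ⋙ G).rightDerived n).obj X ≅ G.obj ((F.rightDerived n).obj X) :=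
  (injectiveResolution X).isoRightDerivedObj (F ⋙ G) n ≪≫
    ShortComplex.mapHomologyIso (((F.mapHomologicalComplex _).obj
      (injectiveResolution X).cocomplex).sc n) G ≪≫
    G.mapIso ((injectiveResolution X).isoRightDerivedObj F n).symm

/-- Left derived functors commute with postcomposition by an exact functor. -/
noncomputable def Functor.leftDerivedCompObjIso [HasProjectiveResolutions C] (F : C ⥤ D)
    [F.Additive] (G : D ⥤ E) [G.Additive] [G.PreservesHomology] (n : ℕ) (X : C) :
    ((F ⋙ G).leftDerived n).obj X ≅ G.obj ((F.leftDerived n).obj X) :=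
  (projectiveResolution X).isoLeftDerivedObj (F ⋙ G) n ≪≫
    ShortComplex.mapHomologyIso (((F.mapHomologicalComplex _).obj
      (projectiveResolution X).complex).sc n) G ≪≫
    G.mapIso ((projectiveResolution X).isoLeftDerivedObj F n).symm

end
end CategoryTheory

/-! ### Elementary facts about finite sets and injections -/

namespace FI

/-- The function underlying a morphism of `FI`. -/
def fn {S T : FI.{u}} (f : S ⟶ T) : S.carrier → T.carrier :=
  (show S.carrier ↪ T.carrier from f)

/-- The morphism of `FI` given by an injective function. -/
def ofInj {S T : FI.{u}} (f : S.carrier → T.carrier) (hf : Function.Injective f) : S ⟶ T :=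
  (⟨f, hf⟩ : S.carrier ↪ T.carrier)

lemma fn_injective {S T : FI.{u}} (f : S ⟶ T) : Function.Injective (fn f) :=
  (show S.carrier ↪ T.carrier from f).injective

lemma hom_ext {S T : FI.{u}} {f g : S ⟶ T} (h : ∀ x, fn f x = fn g x) : f = g :=
  Function.Embedding.ext h

@[simp] lemma fn_comp {S T U : FI.{u}} (f : S ⟶ T) (g : T ⟶ U) (x : S.carrier) :
    fn (f ≫ g) x = fn g (fn f x) := rfl

/-- The finite set `{0, …, n - 1}`. -/
abbrev stdObj (n : ℕ) : FI.{u} := FIMod.std.obj ⟨⟨n⟩⟩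

lemma card_stdObj (n : ℕ) : Nat.card (stdObj.{u} n).carrier = n := by
  change Nat.card (ULift (Fin n)) = n
  simp

lemma exists_iso_stdObj {S : FI.{u}} {n : ℕ} (h : Nat.card S.carrier = n) :
    Nonempty (stdObj.{u} n ≅ S) := by
  obtain ⟨⟨⟨m⟩⟩, ⟨e⟩⟩ := FIMod.exists_iso_std S
  have hm : Nat.card S.carrier = m := by
    rw [← card_stdObj.{u} m]
    exact (Nat.card_congr ⟨fn e.hom, fn e.inv,
      fun x => congr_fun (congr_arg fn e.hom_inv_id) x,
      fun x => congr_fun (congr_arg fn e.inv_hom_id) x⟩).symm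
  obtain rfl : m = n := hm.symm.trans h
  exact ⟨e⟩

lemma card_addPoint (S : FI.{u}) : Nat.card (addPoint.obj S).carrier = Nat.card S.carrier + 1 :=
  Finite.card_option

lemma card_le_of_hom {S T : FI.{u}} (f : S ⟶ T) : Nat.card S.carrier ≤ Nat.card T.carrier :=
  Nat.card_le_card_of_injective _ (fn_injective f)

lemma exists_hom_of_card (S : FI.{u}) (n : ℕ) :
    ∃ (T : FI.{u}) (_ : S ⟶ T), n ≤ Nat.card T.carrier := by
  refine ⟨⟨S.carrier ⊕ ULift.{u} (Fin n), inferInstance⟩,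
    ofInj Sum.inl Sum.inl_injective, ?_⟩
  change n ≤ Nat.card (S.carrier ⊕ ULift.{u} (Fin n))
  simp [Nat.card_sum]

end FI

/-! ### Pointwise criteria, and injectives built from coinduced modules -/

namespace FIMod

section

variable {R : Type} [CommRing R]

/-- Evaluation of an `FI`-module at a finite set. -/
abbrev eval (R : Type) [CommRing R] (S : FI.{u}) : FIMod.{u} R ⥤ ModuleCat.{u} R :=
  (evaluation _ _).obj S

lemma mono_iff_injective {V W : FIMod.{u} R} (f : V ⟶ W) :
    Mono f ↔ ∀ S, Function.Injective (f.app S).hom := by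
  rw [NatTrans.mono_iff_mono_app]
  exact forall_congr' fun S => ModuleCat.mono_iff_injective _

lemma epi_iff_surjective {V W : FIMod.{u} R} (f : V ⟶ W) :
    Epi f ↔ ∀ S, Function.Surjective (f.app S).hom := by
  rw [NatTrans.epi_iff_epi_app]
  exact forall_congr' fun S => ModuleCat.epi_iff_surjective _

lemma exact_iff {T : ShortComplex (FIMod.{u} R)} :
    T.Exact ↔ ∀ S, Function.Exact (T.f.app S).hom (T.g.app S).hom := by
  rw [ShortComplex.exact_iff_isZero_homology, Functor.isZero_iff]
  refine forall_congr' fun S => ?_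
  rw [show T.homology.obj S = (eval R S).obj T.homology from rfl,
    ← (T.mapHomologyIso (eval R S)).isZero_iff, ← ShortComplex.exact_iff_isZero_homology,
    ShortComplex.ShortExact.moduleCat_exact_iff_function_exact]
  rfl

lemma shortExact_iff {T : ShortComplex (FIMod.{u} R)} :
    T.ShortExact ↔ ∀ S, Function.Injective (T.f.app S).hom ∧
      Function.Exact (T.f.app S).hom (T.g.app S).hom ∧ Function.Surjective (T.g.app S).hom := by
  constructor
  · intro h S
    exact ⟨(mono_iff_injective _).1 h.mono_f S, exact_iff.1 h.exact S,
      (epi_iff_surjective _).1 h.epi_g S⟩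
  · intro h
    exact { exact := exact_iff.2 fun S => (h S).2.1
            mono_f := (mono_iff_injective _).2 fun S => (h S).1
            epi_g := (epi_iff_surjective _).2 fun S => (h S).2.2 }

lemma shortExact_shift {T : ShortComplex (FIMod.{u} R)} (hT : T.ShortExact) :
    (T.map (shift R)).ShortExact :=
  shortExact_iff.2 fun S => shortExact_iff.1 hT (FI.addPoint.obj S)

lemma map_comp_apply (V : FIMod.{u} R) {S T U : FI.{u}} (f : S ⟶ T) (g : T ⟶ U) (x : V.obj S) :
    (V.map (f ≫ g)).hom x = (V.map g).hom ((V.map f).hom x) := by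
  rw [V.map_comp]
  rfl

lemma map_id_apply (V : FIMod.{u} R) {S : FI.{u}} (x : V.obj S) :
    (V.map (𝟙 S)).hom x = x := by
  rw [V.map_id]
  rfl

lemma app_map_apply {V W : FIMod.{u} R} (φ : V ⟶ W) {S T : FI.{u}} (f : S ⟶ T) (x : V.obj S) :
    (φ.app T).hom ((V.map f).hom x) = (W.map f).hom ((φ.app S).hom x) :=
  congr_arg (fun t => t.hom x) (φ.naturality f)

lemma comp_app_apply {V W X : FIMod.{u} R} (φ : V ⟶ W) (ψ : W ⟶ X) {S : FI.{u}} (x : V.obj S) :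
    ((φ ≫ ψ).app S).hom x = (ψ.app S).hom ((φ.app S).hom x) := rfl

/-- A morphism of `FI`-modules from its components and elementwise naturality. -/
def homMk {V W : FIMod.{u} R} (φ : ∀ S, V.obj S →ₗ[R] W.obj S)
    (h : ∀ {S T : FI.{u}} (f : S ⟶ T) (x : V.obj S),
      φ T ((V.map f).hom x) = (W.map f).hom (φ S x)) : V ⟶ W where
  app S := ModuleCat.ofHom (φ S)
  naturality S T f := by
    ext x
    exact h f x

lemma isZero_obj_iff {V : FIMod.{u} R} {S : FI.{u}} :
    IsZero (V.obj S) ↔ ∀ x : V.obj S, x = 0 := by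
  rw [ModuleCat.isZero_iff_subsingleton]
  exact ⟨fun h x => Subsingleton.elim _ _, fun h => ⟨fun x y => (h x).trans (h y).symm⟩⟩

/-! ### Coinduced modules -/

section coind

variable {A : Type} (s : A → ℕ) (E : A → ModuleCat.{u} R)

/-- The coinduced `FI`-module `T ↦ ∏ₐ Map(Hom(T, {0, …, s a - 1}), E a)`. -/
def coind : FIMod.{u} R where
  obj T := ModuleCat.of R (∀ a : A, (T ⟶ FI.stdObj.{u} (s a)) → E a)
  map f := ModuleCat.ofHom
    { toFun := fun φ a h => φ a (f ≫ h)
      map_add' := fun _ _ => rfl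
      map_smul' := fun _ _ => rfl }
  map_id T := by
    ext φ a h
    exact congr_arg (φ a) (Category.id_comp h)
  map_comp f g := by
    ext φ a h
    exact congr_arg (φ a) (Category.assoc f g h)

/-- The morphism to a coinduced module determined by a family of linear maps. -/
def toCoind {V : FIMod.{u} R} (ι : ∀ a, V.obj (FI.stdObj (s a)) →ₗ[R] E a) : V ⟶ coind s E :=
  homMk (fun T =>
    { toFun := fun x a h => ι a ((V.map h).hom x)
      map_add' := fun x y => by
        funext a h
        simp only [map_add]
        rfl
      map_smul' := fun c x => by
        funext a h
        simp only [map_smul]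
        rfl }) (fun f x => by
    funext a h
    exact congr_arg (ι a) (map_comp_apply V f h x).symm)

/-- The inclusion of the complement of `i`, with the extra point sent to `i`. -/
def fillPoint {n : ℕ} (i : (FI.stdObj.{u} n).carrier) :
    FI.addPoint.obj (FI.sub {j : (FI.stdObj.{u} n).carrier | j ≠ i}) ⟶ FI.stdObj.{u} n :=
  FI.ofInj (fun j => j.elim i Subtype.val) (by
    rintro (_ | x) (_ | y) h
    · rfl
    · exact absurd h.symm y.2
    · exact absurd h x.2
    · exact congr_arg some (Subtype.ext h))

/-- The restriction of an injection from `T ⊔ {*}` to the complement of the image of `*`. -/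
def dropPoint {T : FI.{u}} {n : ℕ} (h : FI.addPoint.obj T ⟶ FI.stdObj.{u} n) :
    T ⟶ FI.sub {j : (FI.stdObj.{u} n).carrier | j ≠ FI.fn h none} :=
  FI.ofInj (fun t => ⟨FI.fn h (some t), fun e => by simpa using FI.fn_injective h e⟩)
    (fun x y e => Option.some_injective _ (FI.fn_injective h (congr_arg Subtype.val e)))

lemma addPoint_map_dropPoint {T : FI.{u}} {n : ℕ} (h : FI.addPoint.obj T ⟶ FI.stdObj.{u} n) :
    FI.addPoint.map (dropPoint h) ≫ fillPoint (FI.fn h none) = h := by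
  apply FI.hom_ext
  rintro (_ | x) <;> rfl

lemma exists_extension (hE : ∀ a, Injective (E a)) {a : A} {M N : ModuleCat.{u} R} (g : N ⟶ M) (hg : Mono g)
    (l : N →ₗ[R] E a) : ∃ l' : M →ₗ[R] E a, ∀ x, l' (g.hom x) = l x := by
  have := hE a
  refine ⟨(Injective.factorThru (ModuleCat.ofHom l) g).hom, fun x => ?_⟩
  exact congr_arg (fun t => t.hom x) (Injective.comp_factorThru (ModuleCat.ofHom l) g)

/-- A morphism `V ⟶ coind s E` amounts to a family of linear maps from the values of `V` on `{0, …,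
s a - 1}` to `E a`, recovered by evaluating at the identity; each of these extends. -/
lemma injective_coind (hE : ∀ a, Injective (E a)) : Injective (coind s E) := by
  refine ⟨fun {N M} φ g hg => ?_⟩
  have hg' : ∀ S, Mono (g.app S) := fun S => inferInstance
  choose ψ hψ using fun a => exists_extension E hE (a := a) (g.app (FI.stdObj (s a))) (hg' _)
    { toFun := fun x => ((φ.app _).hom x) a (𝟙 _)
      map_add' := fun x y => by rw [map_add]; rfl
      map_smul' := fun c x => by rw [map_smul]; rfl }
  refine ⟨toCoind s E ψ, ?_⟩
  ext T x
  funext a h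
  change ψ a ((M.map h).hom ((g.app T).hom x)) = ((φ.app T).hom x) a h
  rw [← app_map_apply, hψ]
  change ((φ.app _).hom ((N.map h).hom x)) a (𝟙 _) = _
  rw [app_map_apply]
  exact congr_arg (((φ.app T).hom x) a) (Category.comp_id h)

/-- Injections `T ⊔ {*} → [n]` are sorted by the image `i` of `*`, the rest being an injection `T →
[n] \ {i}`. The shift is therefore again coinduced, with one factor for each `i`. -/
lemma injective_shift_coind (hE : ∀ a, Injective (E a)) :
    Injective ((shift R).obj (coind s E)) := by
  refine ⟨fun {N M} φ g hg => ?_⟩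
  have hg' : ∀ S, Mono (g.app S) := fun S => inferInstance
  choose ψ hψ using fun a (i : (FI.stdObj.{u} (s a)).carrier) =>
    exists_extension E hE (a := a) (g.app (FI.sub {j | j ≠ i})) (hg' _)
    { toFun := fun x => ((φ.app _).hom x) a (fillPoint i)
      map_add' := fun x y => by rw [map_add]; rfl
      map_smul' := fun c x => by rw [map_smul]; rfl }
  refine ⟨homMk (fun T =>
    { toFun := fun x a h => ψ a (FI.fn h none) ((M.map (dropPoint h)).hom x)
      map_add' := fun x y => by
        funext a h
        simp only [map_add]
        rfl
      map_smul' := fun c x => by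
        funext a h
        simp only [map_smul]
        rfl }) (fun f x => ?_), ?_⟩
  · funext a h
    exact congr_arg (ψ a (FI.fn h none)) (map_comp_apply M f (dropPoint h) x).symm
  · ext T x
    funext a h
    change ψ a _ ((M.map (dropPoint h)).hom ((g.app T).hom x)) = ((φ.app T).hom x) a h
    rw [← app_map_apply, hψ]
    change ((φ.app _).hom ((N.map (dropPoint h)).hom x)) a _ = _
    rw [app_map_apply]
    exact congr_arg (((φ.app T).hom x) a) (addPoint_map_dropPoint h)

end coind

lemma mono_toCoind {A : Type} (s : A → ℕ) (E : A → ModuleCat.{u} R) {V : FIMod.{u} R}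
    (ι : ∀ a, V.obj (FI.stdObj (s a)) →ₗ[R] E a) (hι : ∀ a, Function.Injective (ι a))
    (hs : ∀ S : FI.{u}, Nat.card S.carrier ∈ Set.range s ∨ IsZero (V.obj S)) :
    Mono (toCoind s E ι) := by
  rw [mono_iff_injective]
  intro S
  rw [injective_iff_map_eq_zero]
  intro x hx
  obtain ⟨a, ha⟩ | h := hs S
  · obtain ⟨e⟩ := FI.exists_iso_stdObj ha.symm
    have h1 : ι a ((V.map e.inv).hom x) = 0 := congr_fun (congr_fun hx a) e.inv
    have h2 : (V.map e.inv).hom x = 0 := hι a (h1.trans (map_zero _).symm)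
    rw [← map_id_apply V x, ← e.inv_hom_id, map_comp_apply, h2, map_zero]
  · exact isZero_obj_iff.1 h x

/-- An injective is a retract of a coinduced module, and the shift preserves retracts. -/
instance injective_shift (I : FIMod.{u} R) [Injective I] : Injective ((shift R).obj I) := by
  let E : ℕ → ModuleCat.{u} R := fun n => Injective.under (I.obj (FI.stdObj n))
  have hE : ∀ n, Injective (E n) := fun n => inferInstance
  let f : I ⟶ coind id E := toCoind id E fun n => (Injective.ι (I.obj (FI.stdObj n))).hom
  have : Mono f := mono_toCoind _ _ _ (fun n => (ModuleCat.mono_iff_injective _).1 inferInstance)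
    fun S => Or.inl ⟨_, rfl⟩
  let r : coind id E ⟶ I := Injective.factorThru (𝟙 I) f
  have hr : f ≫ r = 𝟙 I := Injective.comp_factorThru _ _
  have := injective_shift_coind id E hE
  refine ⟨fun {N M} φ g hg => ?_⟩
  refine ⟨Injective.factorThru (φ ≫ (shift R).map f) g ≫ (shift R).map r, ?_⟩
  rw [← Category.assoc, Injective.comp_factorThru, Category.assoc, ← Functor.map_comp, hr,
    CategoryTheory.Functor.map_id, Category.comp_id]

/-- An `FI`-module vanishing on the sets with at least `n` elements. -/
def VanishesFrom (n : ℕ) (W : FIMod.{u} R) : Prop :=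
  ∀ S : FI.{u}, n ≤ Nat.card S.carrier → IsZero (W.obj S)

/-- Coinduction from the sets of size less than `n` suffices to embed `W`, and such a coinduced
module vanishes on `T` with `|T| ≥ n` because there is no injection from `T` to a smaller set. -/
lemma VanishesFrom.exists_injective {n : ℕ} {W : FIMod.{u} R} (hW : VanishesFrom n W) :
    ∃ (I : FIMod.{u} R) (f : W ⟶ I), Mono f ∧ Injective I ∧ VanishesFrom n I := by
  let s : Fin n → ℕ := fun a => a
  let E : Fin n → ModuleCat.{u} R := fun a => Injective.under (W.obj (FI.stdObj (s a)))
  have hE : ∀ n, Injective (E n) := fun n => inferInstance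
  refine ⟨coind s E, toCoind s E fun a => (Injective.ι (W.obj (FI.stdObj (s a)))).hom,
    mono_toCoind _ _ _ (fun n => (ModuleCat.mono_iff_injective _).1 inferInstance) ?_,
    injective_coind s E hE, ?_⟩
  · intro S
    by_cases h : n ≤ Nat.card S.carrier
    · exact Or.inr (hW S h)
    · exact Or.inl ⟨⟨_, not_le.1 h⟩, rfl⟩
  · intro S hS
    refine isZero_obj_iff.2 fun x => ?_
    funext a h
    have := FI.card_le_of_hom h
    rw [FI.card_stdObj] at this
    have := a.2
    simp only [s] at *
    omega

end
end FIMod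

/-! ### Image factorizations and the snake lemma -/

namespace CategoryTheory.ShortComplex

universe v₁ u₁
variable {C : Type u₁} [Category.{v₁} C] [Abelian C] {S : ShortComplex C}

lemma comp_factorThruImage : S.f ≫ Abelian.factorThruImage S.g = 0 := by
  rw [← cancel_mono (Abelian.image.ι S.g), Category.assoc, Abelian.image.fac, zero_comp, S.zero]

lemma image_ι_comp : Abelian.image.ι S.f ≫ S.g = 0 := by
  rw [← cancel_epi (Abelian.factorThruImage S.f), ← Category.assoc, Abelian.image.fac, comp_zero, S.zero]

lemma Exact.shortExact_factorThruImage (hS : S.Exact) [Mono S.f] :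
    (ShortComplex.mk _ _ S.comp_factorThruImage).ShortExact where
  exact := by
    let α : ShortComplex.mk _ _ S.comp_factorThruImage ⟶ S :=
      { τ₁ := 𝟙 _
        τ₂ := 𝟙 _
        τ₃ := Abelian.image.ι S.g }
    have : Epi α.τ₁ := inferInstanceAs (Epi (𝟙 _))
    have : IsIso α.τ₂ := inferInstanceAs (IsIso (𝟙 _))
    have : Mono α.τ₃ := inferInstanceAs (Mono (Abelian.image.ι S.g))
    exact (ShortComplex.exact_iff_of_epi_of_isIso_of_mono α).2 hS

lemma Exact.shortExact_image_ι (hS : S.Exact) [Epi S.g] :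
    (ShortComplex.mk _ _ S.image_ι_comp).ShortExact where
  exact := by
    let α : S ⟶ ShortComplex.mk _ _ S.image_ι_comp :=
      { τ₁ := Abelian.factorThruImage S.f
        τ₂ := 𝟙 _
        τ₃ := 𝟙 _ }
    have : Epi α.τ₁ := inferInstanceAs (Epi (Abelian.factorThruImage S.f))
    have : IsIso α.τ₂ := inferInstanceAs (IsIso (𝟙 _))
    have : Mono α.τ₃ := inferInstanceAs (Mono (𝟙 _))
    exact (ShortComplex.exact_iff_of_epi_of_isIso_of_mono α).1 hS

/-- The input of the snake lemma given by a morphism of short exact sequences. -/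
noncomputable def SnakeInput.ofHom {T T' : ShortComplex C} (v : T ⟶ T') (hT : T.ShortExact)
    (hT' : T'.ShortExact) : SnakeInput C where
  L₀ := ShortComplex.mk (kernel.map v.τ₁ v.τ₂ T.f T'.f v.comm₁₂)
    (kernel.map v.τ₂ v.τ₃ T.g T'.g v.comm₂₃) (by
      rw [← cancel_mono (kernel.ι _)]; simp)
  L₁ := T
  L₂ := T'
  L₃ := ShortComplex.mk (cokernel.map v.τ₁ v.τ₂ T.f T'.f v.comm₁₂)
    (cokernel.map v.τ₂ v.τ₃ T.g T'.g v.comm₂₃) (by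
      rw [← cancel_epi (cokernel.π _)]; simp)
  v₀₁ :=
    { τ₁ := kernel.ι _
      τ₂ := kernel.ι _
      τ₃ := kernel.ι _ }
  v₁₂ := v
  v₂₃ :=
    { τ₁ := cokernel.π _
      τ₂ := cokernel.π _
      τ₃ := cokernel.π _ }
  w₀₂ := by ext <;> simp
  w₁₃ := by ext <;> simp
  h₀ := ShortComplex.isLimitOfIsLimitπ _
    ((isLimitMapConeForkEquiv' π₁ _).symm (kernelIsKernel v.τ₁))
    ((isLimitMapConeForkEquiv' π₂ _).symm (kernelIsKernel v.τ₂))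
    ((isLimitMapConeForkEquiv' π₃ _).symm (kernelIsKernel v.τ₃))
  h₃ := ShortComplex.isColimitOfIsColimitπ _
    ((isColimitMapCoconeCoforkEquiv' π₁ _).symm (cokernelIsCokernel v.τ₁))
    ((isColimitMapCoconeCoforkEquiv' π₂ _).symm (cokernelIsCokernel v.τ₂))
    ((isColimitMapCoconeCoforkEquiv' π₃ _).symm (cokernelIsCokernel v.τ₃))
  L₁_exact := hT.exact
  epi_L₁_g := hT.epi_g
  L₂_exact := hT'.exact
  mono_L₂_f := hT'.mono_f

end CategoryTheory.ShortComplex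

namespace FIMod

section

variable {R : Type} [CommRing R]

/-! ### Vanishing of local cohomology -/

instance (S : FI.{u}) : PreservesFiniteLimits (torsion R ⋙ eval R S) := by
  refine ((torsion R ⋙ eval R S).preservesFiniteLimits_tfae.out 0 3 :).1 fun T hT => ?_
  obtain ⟨hf, hfg, hg⟩ := shortExact_iff.1 hT S
  constructor
  · rw [ShortComplex.ShortExact.moduleCat_exact_iff_function_exact]
    rintro ⟨y, hy⟩
    constructor
    · intro h
      obtain ⟨x, hx⟩ := (hfg y).1 (congr_arg Subtype.val h)
      refine ⟨⟨x, ?_⟩, Subtype.ext hx⟩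
      obtain ⟨U, α, hα⟩ := hy
      refine ⟨U, α, (shortExact_iff.1 hT U).1 ?_⟩
      rw [app_map_apply, hx, hα, map_zero]
    · rintro ⟨x, hx⟩
      refine Subtype.ext ((hfg y).2 ⟨x.1, congr_arg Subtype.val hx⟩)
  · refine (ModuleCat.mono_iff_injective _).2 fun x y h => Subtype.ext (hf ?_)
    exact congr_arg Subtype.val h

/-- Vanishing of the `j`-th local cohomology of `V` at the finite set `S`. -/
def LCVanishes (j : ℕ) (V : FIMod.{u} R) (S : FI.{u}) : Prop :=
  IsZero (((localCohomology R j).obj V).obj S)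

/-- Evaluation is exact, so it passes through derived functors; the vanishing criteria then apply
one set at a time. -/
lemma lcVanishes_iff {j : ℕ} {V : FIMod.{u} R} {S : FI.{u}} :
    LCVanishes j V S ↔ IsZero (((torsion R ⋙ eval R S).rightDerived j).obj V) :=
  ((torsion R).rightDerivedCompObjIso (eval R S) j V).isZero_iff.symm

lemma lcVanishes_zero_iff {V : FIMod.{u} R} {S : FI.{u}} :
    LCVanishes 0 V S ↔ ∀ x ∈ torsionAt V S, x = 0 := by
  rw [lcVanishes_iff, ((torsion R ⋙ eval R S).rightDerivedZeroIsoSelf.app V).isZero_iff]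
  refine (isZero_obj_iff (V := (torsion R).obj V)).trans ?_
  exact ⟨fun h x hx => congr_arg Subtype.val (h ⟨x, hx⟩), fun h x => Subtype.ext (h x.1 x.2)⟩

section ses

variable {T : ShortComplex (FIMod.{u} R)}

lemma lcVanishes_one_iff (hT : T.ShortExact) (hI : Injective T.X₂) {S : FI.{u}} :
    LCVanishes 1 T.X₁ S ↔
      ∀ z ∈ torsionAt T.X₃ S, ∃ y ∈ torsionAt T.X₂ S, (T.g.app S).hom y = z := by
  rw [lcVanishes_iff, hT.isZero_rightDerived_one_iff _ hI, ModuleCat.epi_iff_surjective]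
  constructor
  · intro h z hz
    obtain ⟨y, hy⟩ := h ⟨z, hz⟩
    exact ⟨y.1, y.2, congr_arg Subtype.val hy⟩
  · rintro h ⟨z, hz⟩
    obtain ⟨y, hy, rfl⟩ := h z hz
    exact ⟨⟨y, hy⟩, rfl⟩

lemma lcVanishes_add_two_iff (hT : T.ShortExact) (hI : Injective T.X₂) {S : FI.{u}} (j : ℕ) :
    LCVanishes (j + 2) T.X₁ S ↔ LCVanishes (j + 1) T.X₃ S := by
  rw [lcVanishes_iff, lcVanishes_iff, hT.isZero_rightDerived_iff _ hI]

lemma lcVanishes_X₃ (hT : T.ShortExact) {S : FI.{u}} {j : ℕ} (h2 : LCVanishes j T.X₂ S)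
    (h1 : LCVanishes (j + 1) T.X₁ S) : LCVanishes j T.X₃ S := by
  rw [lcVanishes_iff] at *
  exact hT.isZero_rightDerived_X₃ _ j h2 h1

end ses

lemma exists_injective_shortExact (V : FIMod.{u} R) : ∃ (I Q : FIMod.{u} R) (f : V ⟶ I)
    (g : I ⟶ Q) (w : f ≫ g = 0), Injective I ∧ (ShortComplex.mk f g w).ShortExact :=
  ⟨_, _, Injective.ι V, cokernel.π _, cokernel.condition _, inferInstance,
    { exact := ShortComplex.exact_cokernel _
      mono_f := inferInstanceAs (Mono (Injective.ι V))
      epi_g := inferInstanceAs (Epi (cokernel.π _)) }⟩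

lemma mem_torsionAt_shift {V : FIMod.{u} R} {S : FI.{u}} {x : V.obj (FI.addPoint.obj S)} :
    x ∈ torsionAt ((shift R).obj V) S ↔ x ∈ torsionAt V (FI.addPoint.obj S) := by
  constructor
  · rintro ⟨T, α, h⟩
    exact ⟨_, FI.addPoint.map α, h⟩
  · rintro ⟨T, β, h⟩
    classical
    -- An arbitrary `β` need not have the form `α ⊔ {*}`. Following it by the map that moves `β(*)`
    -- to the new point gives it that form, with `α` the restriction of `β` to `S`.
    let σ : T ⟶ FI.addPoint.obj T :=
      FI.ofInj (fun t => if t = FI.fn β none then none else some t) (fun a b hab => by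
        by_cases ha : a = FI.fn β none <;> by_cases hb : b = FI.fn β none <;>
          simp_all
        exact Option.some_injective _ hab)
    let α : S ⟶ T := FI.ofInj (fun s => FI.fn β (some s)) fun a b hab =>
      Option.some_injective _ (FI.fn_injective β hab)
    have hα : FI.addPoint.map α = β ≫ σ := by
      apply FI.hom_ext
      rintro (_ | s)
      · exact (if_pos rfl).symm
      · refine (if_neg fun e => ?_).symm
        simpa using FI.fn_injective β e
    refine ⟨T, α, ?_⟩
    change (V.map (FI.addPoint.map α)).hom x = 0
    rw [hα, map_comp_apply, h, map_zero]

/-- The shift is exact, preserves injectives and commutes with torsion, so dimension shifting for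
`V` and for its shift runs in parallel. -/
lemma lcVanishes_shift {j : ℕ} : ∀ {V : FIMod.{u} R} {S : FI.{u}},
    LCVanishes j V (FI.addPoint.obj S) → LCVanishes j ((shift R).obj V) S := by
  have key (V : FIMod.{u} R) := exists_injective_shortExact V
  match j with
  | 0 =>
    intro V S h
    rw [lcVanishes_zero_iff] at *
    exact fun x hx => h x (mem_torsionAt_shift.1 hx)
  | 1 =>
    intro V S h
    obtain ⟨I, Q, f, g, w, hI, hT⟩ := key V
    refine (lcVanishes_one_iff (shortExact_shift hT) (injective_shift I)).2 fun z hz => ?_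
    obtain ⟨y, hy, hyz⟩ := (lcVanishes_one_iff hT hI).1 h z (mem_torsionAt_shift.1 hz)
    exact ⟨y, mem_torsionAt_shift.2 hy, hyz⟩
  | j + 2 =>
    intro V S h
    obtain ⟨I, Q, f, g, w, hI, hT⟩ := key V
    exact (lcVanishes_add_two_iff (shortExact_shift hT) (injective_shift I) j).2
      (lcVanishes_shift ((lcVanishes_add_two_iff hT hI j).1 h))

lemma VanishesFrom.mem_torsionAt {n : ℕ} {W : FIMod.{u} R} (hW : VanishesFrom n W) {S : FI.{u}}
    (x : W.obj S) : x ∈ torsionAt W S := by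
  obtain ⟨T, α, hT⟩ := FI.exists_hom_of_card S n
  exact ⟨T, α, isZero_obj_iff.1 (hW T hT) _⟩

lemma VanishesFrom.of_epi {n : ℕ} {V W : FIMod.{u} R} (f : V ⟶ W) [Epi f]
    (hV : VanishesFrom n V) : VanishesFrom n W :=
  fun S hS => IsZero.of_epi (f.app S) (hV S hS)

lemma VanishesFrom.of_mono {n : ℕ} {V W : FIMod.{u} R} (f : V ⟶ W) [Mono f]
    (hW : VanishesFrom n W) : VanishesFrom n V :=
  fun S hS => IsZero.of_mono (f.app S) (hW S hS)

/-- Modules vanishing on large sets are all torsion, and they have injective hulls-to-be and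
cokernels of the same kind, so taking torsion loses no exactness. -/
lemma VanishesFrom.lcVanishes_succ {n : ℕ} (j : ℕ) {S : FI.{u}} : ∀ {W : FIMod.{u} R},
    VanishesFrom n W → LCVanishes (j + 1) W S := by
  induction j with
  | zero =>
    intro W hW
    obtain ⟨I, f, hf, hI, hIn⟩ := hW.exists_injective
    have hT : (ShortComplex.mk f (cokernel.π f) (cokernel.condition f)).ShortExact :=
      { exact := ShortComplex.exact_cokernel _ }
    refine (lcVanishes_one_iff hT hI).2 fun z hz => ?_
    obtain ⟨y, hy⟩ := (shortExact_iff.1 hT S).2.2 z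
    exact ⟨y, hIn.mem_torsionAt y, hy⟩
  | succ j ih =>
    intro W hW
    obtain ⟨I, f, hf, hI, hIn⟩ := hW.exists_injective
    have hT : (ShortComplex.mk f (cokernel.π f) (cokernel.condition f)).ShortExact :=
      { exact := ShortComplex.exact_cokernel _ }
    exact (lcVanishes_add_two_iff hT hI j).2 (ih (hIn.of_epi (cokernel.π f)))

/-! ### The kernel of `V ⟶ ΣV` and the local cohomology of the derivative -/

variable (R) in
/-- The kernel of the natural map from an `FI`-module to its shift. -/
noncomputable abbrev kerShift (V : FIMod.{u} R) : FIMod.{u} R := kernel ((toShift R).app V)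

lemma LCVanishes.derivative {n : ℕ} {V : FIMod.{u} R} (hV : VanishesFrom n (kerShift R V))
    {j : ℕ} {S : FI.{u}} (h1 : LCVanishes j V (FI.addPoint.obj S))
    (h2 : LCVanishes (j + 1) V S) : LCVanishes j ((derivative R).obj V) S := by
  let f := (toShift R).app V
  have hT := (ShortComplex.exact_cokernel f).shortExact_image_ι
  have hT' := (ShortComplex.exact_kernel f).shortExact_factorThruImage
  exact lcVanishes_X₃ hT (lcVanishes_shift h1) (lcVanishes_X₃ hT' h2 (hV.lcVanishes_succ _))

end
end FIMod

namespace FIMod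

section

variable {R : Type} [CommRing R]

/-! ### Generation in finite degrees -/

lemma range_map_le_fromProper (V : FIMod.{u} R) {S T : FI.{u}} (f : S ⟶ T)
    (hf : ¬ Function.Surjective (FI.fn f)) : LinearMap.range (V.map f).hom ≤ fromProper V T := by
  let A : Set T.carrier := Set.range (FI.fn f)
  let g : S ⟶ FI.sub A := FI.ofInj (fun x => ⟨FI.fn f x, x, rfl⟩)
    fun x y h => FI.fn_injective f (congr_arg Subtype.val h)
  have hfg : f = g ≫ FI.incl A := FI.hom_ext fun x => rfl
  have hA : A ≠ Set.univ := fun h => hf (Set.range_eq_univ.1 h)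
  rintro _ ⟨x, rfl⟩
  rw [hfg, map_comp_apply]
  exact le_iSup₂ (f := fun (A : Set T.carrier) (_ : A ≠ Set.univ) =>
    LinearMap.range (V.map (FI.incl A)).hom) A hA ⟨_, rfl⟩

lemma fromProper_le {V : FIMod.{u} R} {S : FI.{u}} {N : Submodule R (V.obj S)}
    (h : ∀ (A : Set S.carrier), A ≠ Set.univ → ∀ x, (V.map (FI.incl A)).hom x ∈ N) :
    fromProper V S ≤ N :=
  iSup₂_le fun A hA => by
    rintro _ ⟨x, rfl⟩
    exact h A hA x

lemma not_surjective_incl {S : FI.{u}} {A : Set S.carrier} (hA : A ≠ Set.univ) :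
    ¬ Function.Surjective (FI.fn (FI.incl A)) := fun h =>
  hA (Set.eq_univ_of_forall fun x => by
    obtain ⟨y, rfl⟩ := h x
    exact y.2)

lemma fromProper_le_map_app {V W : FIMod.{u} R} (φ : V ⟶ W) [Epi φ] (S : FI.{u}) :
    fromProper W S ≤ (fromProper V S).map (φ.app S).hom := by
  refine fromProper_le fun A hA x => ?_
  obtain ⟨y, rfl⟩ := (epi_iff_surjective φ).1 inferInstance _ x
  rw [← app_map_apply]
  exact ⟨_, range_map_le_fromProper V _ (not_surjective_incl hA) ⟨y, rfl⟩, rfl⟩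

/-- Generation by the elements on the sets with less than `n` elements. -/
def GenBelow (n : ℕ) (V : FIMod.{u} R) : Prop :=
  ∀ S : FI.{u}, n ≤ Nat.card S.carrier → fromProper V S = ⊤

/-- Generation in finite degrees. -/
def FinGen (V : FIMod.{u} R) : Prop := ∃ n, GenBelow n V

lemma GenBelow.of_epi {n : ℕ} {V W : FIMod.{u} R} (φ : V ⟶ W) [Epi φ] (hV : GenBelow n V) :
    GenBelow n W := by
  intro S hS
  refine eq_top_iff.2 fun y _ => ?_
  obtain ⟨x, rfl⟩ := (epi_iff_surjective φ).1 inferInstance _ y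
  exact fromProper_le_comap_app φ S (hV S hS ▸ Submodule.mem_top : x ∈ fromProper V S)

lemma FinGen.of_epi {V W : FIMod.{u} R} (φ : V ⟶ W) [Epi φ] : FinGen V → FinGen W
  | ⟨n, hn⟩ => ⟨n, hn.of_epi φ⟩

lemma FinGen.ext {T : ShortComplex (FIMod.{u} R)} (hT : T.ShortExact) (h1 : FinGen T.X₁)
    (h3 : FinGen T.X₃) : FinGen T.X₂ := by
  obtain ⟨n, hn⟩ := h1
  obtain ⟨m, hm⟩ := h3
  refine ⟨max n m, fun S hS => eq_top_iff.2 fun y _ => ?_⟩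
  have := hT.epi_g
  obtain ⟨y', hy', e⟩ := fromProper_le_map_app T.g S
    (hm S (le_trans (le_max_right _ _) hS) ▸ Submodule.mem_top :
      (T.g.app S).hom y ∈ fromProper T.X₃ S)
  obtain ⟨x, hx⟩ := ((shortExact_iff.1 hT S).2.1 (y - y')).1 (by rw [map_sub, e, sub_self])
  rw [← sub_add_cancel y y', ← hx]
  refine add_mem (fromProper_le_comap_app T.f S ?_) hy'
  exact hn S (le_trans (le_max_left _ _) hS) ▸ Submodule.mem_top

/-- A proper subset of `S` can be enlarged to the complement of one point, which still has at least
`w` elements; there `T.X₁` and `T.X₂` agree. The `+ 1` pays for the removed point. -/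
lemma VanishesFrom.genBelow_X₁ {w m : ℕ} {T : ShortComplex (FIMod.{u} R)} (hT : T.ShortExact)
    (h3 : VanishesFrom w T.X₃) (h2 : GenBelow m T.X₂) : GenBelow (max m w + 1) T.X₁ := by
  intro S hS
  refine eq_top_iff.2 fun z _ => ?_
  have key : fromProper T.X₂ S ≤ (fromProper T.X₁ S).map (T.f.app S).hom := by
    refine fromProper_le fun A hA b => ?_
    obtain ⟨s, hs⟩ := (Set.ne_univ_iff_exists_notMem A).1 hA
    let A' : Set S.carrier := {t | t ≠ s}
    have hA' : A' ≠ Set.univ := (Set.ne_univ_iff_exists_notMem A').2 ⟨s, fun h => h rfl⟩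
    let g : FI.sub A ⟶ FI.sub A' := FI.ofInj (fun a => ⟨a.1, fun h => hs (h ▸ a.2)⟩)
      fun x y h => Subtype.ext (congr_arg (fun t : A' => t.1) h)
    have hg : FI.incl A = g ≫ FI.incl A' := FI.hom_ext fun x => rfl
    have hc : w ≤ Nat.card (FI.sub A').carrier := by
      have e : Nat.card (FI.sub A').carrier + 1 = Nat.card S.carrier := by
        rw [← FI.card_addPoint]
        classical
        exact Nat.card_congr (Equiv.optionSubtypeNe s)
      have := le_max_right m w
      omega
    obtain ⟨z', hz'⟩ := ((shortExact_iff.1 hT (FI.sub A')).2.1 ((T.X₂.map g).hom b)).1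
      (isZero_obj_iff.1 (h3 _ hc) _)
    refine ⟨(T.X₁.map (FI.incl A')).hom z',
      range_map_le_fromProper _ _ (not_surjective_incl hA') ⟨_, rfl⟩, ?_⟩
    rw [app_map_apply, hz', hg, map_comp_apply]
  obtain ⟨z', hz', e⟩ := key (h2 S ((le_max_left m w).trans (by omega)) ▸ Submodule.mem_top :
    (T.f.app S).hom z ∈ fromProper T.X₂ S)
  exact (shortExact_iff.1 hT S).1 e ▸ hz'

/-! ### Generation of derivatives -/

/-- The projection from the shift of an `FI`-module to its derivative. -/
noncomputable def shiftπ (V : FIMod.{u} R) : (shift R).obj V ⟶ (derivative R).obj V :=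
  cokernel.π ((toShift R).app V)

/-- The natural map from an `FI`-module to its shift. -/
def shiftι (V : FIMod.{u} R) : V ⟶ (shift R).obj V := (toShift R).app V

instance (V : FIMod.{u} R) : Epi (shiftπ V) :=
  inferInstanceAs (Epi (cokernel.π ((toShift R).app V)))

lemma shiftι_π (V : FIMod.{u} R) : shiftι V ≫ shiftπ V = 0 :=
  cokernel.condition ((toShift R).app V)

lemma exact_shiftι_π (V : FIMod.{u} R) : (ShortComplex.mk _ _ (shiftι_π V)).Exact :=
  ShortComplex.exact_cokernel ((toShift R).app V)

lemma shiftι_naturality {V W : FIMod.{u} R} (φ : V ⟶ W) :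
    shiftι V ≫ (shift R).map φ = φ ≫ shiftι W :=
  ((toShift R).naturality φ).symm

lemma shiftπ_naturality {V W : FIMod.{u} R} (φ : V ⟶ W) :
    shiftπ V ≫ (derivative R).map φ = (shift R).map φ ≫ shiftπ W :=
  cokernel.π_desc _ _ _

lemma shiftπ_surjective (V : FIMod.{u} R) (S : FI.{u})
    (y : ((derivative R).obj V).obj S) : ∃ x : V.obj (FI.addPoint.obj S),
      ((shiftπ V).app S).hom x = y :=
  (epi_iff_surjective (shiftπ V)).1 inferInstance S y

lemma shiftπ_eq_zero_iff (V : FIMod.{u} R) (S : FI.{u}) (x : V.obj (FI.addPoint.obj S)) :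
    ((shiftπ V).app S).hom x = 0 ↔ ∃ y, (V.map (FI.inclPoint.app S)).hom y = x :=
  exact_iff.1 (exact_shiftι_π V) S x

/-- A proper subset of `S ⊔ {*}` containing `*` comes from a proper subset of `S`; one missing `*`
contributes elements in the image of `V_S`, which die in the derivative. -/
lemma GenBelow.derivative {n : ℕ} {V : FIMod.{u} R} (hV : GenBelow (n + 1) V) :
    GenBelow n ((derivative R).obj V) := by
  intro S hS
  refine eq_top_iff.2 fun y _ => ?_
  obtain ⟨x, rfl⟩ := shiftπ_surjective V S y
  have key : fromProper V (FI.addPoint.obj S) ≤ (fromProper ((FIMod.derivative R).obj V) S).comap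
      ((shiftπ V).app S).hom := by
    refine fromProper_le fun A hA b => ?_
    rw [Submodule.mem_comap]
    by_cases hn : none ∈ A
    · classical
      let A₀ : Set S.carrier := {s | some s ∈ A}
      have hA₀ : A₀ ≠ Set.univ := fun h => hA <| Set.eq_univ_of_forall <| by
        rintro (_ | s)
        · exact hn
        · exact (h ▸ Set.mem_univ s : s ∈ A₀)
      let f : A → Option A₀ := fun a => match a with
        | ⟨none, _⟩ => none
        | ⟨some s, hs⟩ => some ⟨s, hs⟩
      have hf : Function.Injective f := by
        rintro ⟨_ | s, hs⟩ ⟨_ | t, ht⟩ h <;> simp_all [f]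
      let k : FI.sub A ⟶ FI.addPoint.obj (FI.sub A₀) := FI.ofInj f hf
      have hk : FI.incl A = k ≫ FI.addPoint.map (FI.incl A₀) := by
        apply FI.hom_ext
        rintro ⟨_ | s, hs⟩ <;> rfl
      rw [hk, map_comp_apply]
      have e := app_map_apply (shiftπ V) (FI.incl A₀) ((V.map k).hom b)
      refine Eq.mpr (congrArg (· ∈ fromProper ((FIMod.derivative R).obj V) S) e) ?_
      exact range_map_le_fromProper _ _ (not_surjective_incl hA₀) ⟨_, rfl⟩
    · have h1 (a : A) : ∃ s, some s = a.1 := by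
        obtain ⟨_ | s, hs⟩ := a
        · exact absurd hs hn
        · exact ⟨s, rfl⟩
      choose k hk using h1
      let k' : FI.sub A ⟶ S := FI.ofInj k fun a b h =>
        Subtype.ext ((hk a).symm.trans ((congr_arg some h).trans (hk b)))
      have hk' : FI.incl A = k' ≫ FI.inclPoint.app S := FI.hom_ext fun a => (hk a).symm
      rw [hk', map_comp_apply, (shiftπ_eq_zero_iff V S _).2 ⟨_, rfl⟩]
      exact zero_mem _
  refine key ?_
  rw [hV _ (by rw [FI.card_addPoint]; omega)]
  exact Submodule.mem_top

lemma FinGen.derivative {V : FIMod.{u} R} : FinGen V → FinGen ((derivative R).obj V)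
  | ⟨n, hn⟩ => ⟨n, GenBelow.derivative fun S hS => hn S (by omega)⟩

lemma GenBelow.of_derivative {n : ℕ} {V : FIMod.{u} R}
    (hV : GenBelow n ((FIMod.derivative R).obj V)) : GenBelow (n + 1) V := by
  have key (S : FI.{u}) (hS : n ≤ Nat.card S.carrier) (z : V.obj (FI.addPoint.obj S)) :
      z ∈ fromProper V (FI.addPoint.obj S) := by
    obtain ⟨z', hz', e⟩ : ∃ z' : V.obj (FI.addPoint.obj S),
        z' ∈ fromProper ((shift R).obj V) S ∧
          ((shiftπ V).app S).hom z' = ((shiftπ V).app S).hom z :=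
      fromProper_le_map_app (shiftπ V) S (hV S hS ▸ Submodule.mem_top :
        ((shiftπ V).app S).hom z ∈ fromProper ((FIMod.derivative R).obj V) S)
    obtain ⟨z'', h⟩ := (shiftπ_eq_zero_iff V S (z - z')).1
      ((map_sub ((shiftπ V).app S).hom z z').trans (sub_eq_zero.2 e.symm))
    have h1 : fromProper ((shift R).obj V) S ≤ fromProper V (FI.addPoint.obj S) := by
      refine fromProper_le fun A hA b => ?_
      refine range_map_le_fromProper V (FI.addPoint.map (FI.incl A)) (fun hs => ?_) ⟨b, rfl⟩
      refine not_surjective_incl hA fun s => ?_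
      obtain ⟨_ | a, ha⟩ := hs (some s)
      · cases ha
      · exact ⟨a, Option.some_injective _ ha⟩
    have h2 : z - z' ∈ fromProper V (FI.addPoint.obj S) := by
      rw [← h]
      refine range_map_le_fromProper V _ (fun hs => ?_) ⟨_, rfl⟩
      obtain ⟨s, hs⟩ := hs none
      cases hs
    rw [← sub_add_cancel z z']
    exact add_mem h2 (h1 hz')
  intro T hT
  obtain ⟨m, hm⟩ : ∃ m, Nat.card T.carrier = m + 1 := ⟨Nat.card T.carrier - 1, by omega⟩
  obtain ⟨e⟩ := FI.exists_iso_stdObj hm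
  obtain ⟨e'⟩ := FI.exists_iso_stdObj (S := FI.addPoint.obj (FI.stdObj.{u} m)) (n := m + 1)
    (by rw [FI.card_addPoint, FI.card_stdObj])
  let i := e'.symm ≪≫ e
  refine eq_top_iff.2 fun z _ => ?_
  have h := fromProper_le_comap V i.hom
    (key (FI.stdObj m) (by rw [FI.card_stdObj]; omega) ((V.map i.inv).hom z))
  rw [Submodule.mem_comap] at h
  have h' := map_comp_apply V i.inv i.hom z
  rw [i.inv_hom_id, map_id_apply] at h'
  rwa [← h'] at h

lemma FinGen.of_derivative {V : FIMod.{u} R} : FinGen ((FIMod.derivative R).obj V) → FinGen V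
  | ⟨n, hn⟩ => ⟨n + 1, hn.of_derivative⟩

/-- Every inclusion of a proper subset factors through adding one point, which kills the kernel.
Hence its `fromProper` is zero, and generation forces vanishing. -/
lemma GenBelow.vanishesFrom_kerShift {n : ℕ} {V : FIMod.{u} R}
    (hV : GenBelow n (kerShift R V)) : VanishesFrom n (kerShift R V) := by
  intro S hS
  have key : fromProper (kerShift R V) S ≤ ⊥ := by
    refine fromProper_le fun A hA x => ?_
    obtain ⟨s, hs⟩ := (Set.ne_univ_iff_exists_notMem A).1 hA
    let k : FI.addPoint.obj (FI.sub A) ⟶ S := FI.ofInj (fun a => a.elim s Subtype.val) (by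
      rintro (_ | x) (_ | y) h
      · rfl
      · exact absurd ((show s = y.1 from h) ▸ y.2 : s ∈ A) hs
      · exact absurd ((show x.1 = s from h) ▸ x.2 : s ∈ A) hs
      · exact congr_arg some (Subtype.ext h))
    have hk : FI.incl A = FI.inclPoint.app _ ≫ k := FI.hom_ext fun x => rfl
    let ι : kerShift R V ⟶ V := kernel.ι ((toShift R).app V)
    refine (Submodule.mem_bot R).2 ((mono_iff_injective ι).1 inferInstance S ?_)
    rw [app_map_apply, hk, map_comp_apply, map_zero]
    have h0 : (V.map (FI.inclPoint.app _)).hom ((ι.app _).hom x) = 0 :=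
      congr_arg (fun t : kerShift R V ⟶ (shift R).obj V => (t.app (FI.sub A)).hom x)
        (kernel.condition (shiftι V))
    exact (congr_arg _ h0).trans (map_zero _)
  refine isZero_obj_iff.2 fun x => (Submodule.mem_bot R).1 (key ?_)
  rw [hV S hS]
  exact Submodule.mem_top

/-! ### Split modules -/

/-- The natural map to the shift is a split monomorphism. -/
def SplitShift (P : FIMod.{u} R) : Prop :=
  ∃ r : (shift R).obj P ⟶ P, shiftι P ≫ r = 𝟙 P

lemma SplitShift.isZero_kerShift {P : FIMod.{u} R} : SplitShift P → IsZero (kerShift R P)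
  | ⟨r, hr⟩ => by
    have : Mono (shiftι P) := mono_of_mono_fac hr
    exact isZero_kernel_of_mono (shiftι P)

/-- The exchange of the two points added by a double shift. -/
def swapPoints (S : FI.{u}) :
    FI.addPoint.obj (FI.addPoint.obj S) ⟶ FI.addPoint.obj (FI.addPoint.obj S) :=
  FI.ofInj (fun x : Option (Option S.carrier) => match x with
    | none => some none
    | some none => none
    | some (some s) => some (some s)) (by
      rintro (_ | _ | x) (_ | _ | y) h
      all_goals first | rfl | cases h
      rfl)

/-- The exchange of the two points added by a double shift. -/
def swapShift (V : FIMod.{u} R) :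
    (shift R).obj ((shift R).obj V) ⟶ (shift R).obj ((shift R).obj V) where
  app S := V.map (swapPoints S)
  naturality S T f := by
    change V.map _ ≫ V.map _ = V.map _ ≫ V.map _
    rw [← V.map_comp, ← V.map_comp]
    refine congr_arg V.map (FI.hom_ext ?_)
    rintro (_ | _ | x) <;> rfl

lemma shiftι_shift_swap (V : FIMod.{u} R) :
    shiftι ((shift R).obj V) ≫ swapShift V = (shift R).map (shiftι V) := by
  ext1
  funext S
  change V.map _ ≫ V.map (swapPoints S) = V.map _
  rw [← V.map_comp]
  refine congr_arg V.map (FI.hom_ext ?_)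
  rintro (_ | x) <;> rfl

lemma shift_shiftι_swap (V : FIMod.{u} R) :
    (shift R).map (shiftι V) ≫ swapShift V = shiftι ((shift R).obj V) := by
  ext1
  funext S
  change V.map _ ≫ V.map (swapPoints S) = V.map _
  rw [← V.map_comp]
  refine congr_arg V.map (FI.hom_ext ?_)
  rintro (_ | x) <;> rfl

/-- Shifting `r` retracts the shift of `shiftι P`, whereas a retraction of `shiftι` of the shift is
needed. The two maps differ by swapping the two added points, so `swapShift` is inserted before
descending to the cokernel. -/
lemma SplitShift.derivative {P : FIMod.{u} R} (hP : SplitShift P) :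
    SplitShift ((derivative R).obj P) := by
  obtain ⟨r, hr⟩ := hP
  have w : (shift R).map (shiftι P) ≫ (shift R).map (shiftπ P) = 0 := by
    rw [← Functor.map_comp, shiftι_π, Functor.map_zero]
  have hex : (ShortComplex.mk _ _ w).Exact :=
    exact_iff.2 fun S => exact_iff.1 (exact_shiftι_π P) (FI.addPoint.obj S)
  have hepi : Epi ((shift R).map (shiftπ P)) := (epi_iff_surjective _).2 fun S =>
    (epi_iff_surjective (shiftπ P)).1 inferInstance (FI.addPoint.obj S)
  have h0 : (shift R).map (shiftι P) ≫ swapShift P ≫ (shift R).map r ≫ shiftπ P = 0 := by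
    rw [← Category.assoc, shift_shiftι_swap, ← Category.assoc, shiftι_naturality, Category.assoc,
      shiftι_π, comp_zero]
  obtain ⟨r', hr'⟩ : ∃ r' : (shift R).obj ((FIMod.derivative R).obj P) ⟶
      (FIMod.derivative R).obj P,
      (shift R).map (shiftπ P) ≫ r' = swapShift P ≫ (shift R).map r ≫ shiftπ P :=
    ⟨hex.desc _ h0, hex.g_desc _ _⟩
  refine ⟨r', ?_⟩
  rw [← cancel_epi (shiftπ P), ← Category.assoc, ← shiftι_naturality, Category.assoc, hr',
    ← Category.assoc, shiftι_shift_swap, ← Category.assoc, ← Functor.map_comp, hr,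
    CategoryTheory.Functor.map_id, Category.id_comp, Category.comp_id]

end
end FIMod

namespace FIMod

section

variable {R : Type} [CommRing R]

/-! ### Exactness properties of the derivative -/

/-- The snake lemma for a short exact sequence and its shift. -/
noncomputable def snake {T : ShortComplex (FIMod.{u} R)} (hT : T.ShortExact) :
    ShortComplex.SnakeInput (FIMod.{u} R) :=
  ShortComplex.SnakeInput.ofHom (T' := T.map (shift R))
    { τ₁ := shiftι T.X₁
      τ₂ := shiftι T.X₂
      τ₃ := shiftι T.X₃
      comm₁₂ := shiftι_naturality T.f
      comm₂₃ := shiftι_naturality T.g } hT (shortExact_shift hT)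

lemma exact_map_derivative {T : ShortComplex (FIMod.{u} R)} (hT : T.ShortExact) :
    (T.map (derivative R)).Exact := (snake hT).L₃_exact

lemma epi_map_derivative {T : ShortComplex (FIMod.{u} R)} (hT : T.ShortExact) :
    Epi ((derivative R).map T.g) := by
  have := (shortExact_shift hT).epi_g
  have : Epi (snake hT).L₂.g := this
  exact inferInstanceAs (Epi (snake hT).L₃.g)

instance : PreservesFiniteColimits (derivative.{u} R) :=
  ((derivative R).preservesFiniteColimits_tfae.out 0 3 :).1 fun _ hT =>
    ⟨exact_map_derivative hT, epi_map_derivative hT⟩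

lemma shortExact_map_derivative {T : ShortComplex (FIMod.{u} R)} (hT : T.ShortExact)
    (h : IsZero (kerShift R T.X₃)) : (T.map (derivative R)).ShortExact where
  exact := exact_map_derivative hT
  mono_f := (snake hT).L₂'_exact.mono_g (h.eq_of_src _ _)
  epi_g := epi_map_derivative hT

/-- The connecting map of the snake lemma; it is injective because the kernel for the middle term is
zero. -/
lemma exists_exact_derivative {T : ShortComplex (FIMod.{u} R)} (hT : T.ShortExact)
    (h : IsZero (kerShift R T.X₂)) :
    ∃ (δ : kerShift R T.X₃ ⟶ (derivative R).obj T.X₁) (w : δ ≫ (derivative R).map T.f = 0),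
      Mono δ ∧ (ShortComplex.mk _ _ w).Exact :=
  ⟨(snake hT).δ, (snake hT).δ_L₃_f, (snake hT).L₁'_exact.mono_g (h.eq_of_src _ _),
    (snake hT).L₂'_exact⟩

/-! ### Presentation in finite degrees -/

/-- `C` is generated in finite degrees, and so is the kernel of any epimorphism to `C` from a
module generated in finite degrees. -/
def FinPres (C : FIMod.{u} R) : Prop :=
  FinGen C ∧ ∀ (A B : FIMod.{u} R) (f : A ⟶ B) (g : B ⟶ C) (w : f ≫ g = 0),
    (ShortComplex.mk f g w).ShortExact → FinGen B → FinGen A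

lemma VanishesFrom.finGen {n : ℕ} {W : FIMod.{u} R} (hW : VanishesFrom n W) : FinGen W :=
  ⟨n, fun S hS => eq_top_iff.2 fun x _ => by
    rw [isZero_obj_iff.1 (hW S hS) x]
    exact zero_mem _⟩

lemma VanishesFrom.finPres {n : ℕ} {W : FIMod.{u} R} (hW : VanishesFrom n W) : FinPres W :=
  ⟨hW.finGen, fun _ _ _ _ _ hT ⟨_, hm⟩ => ⟨_, VanishesFrom.genBelow_X₁ hT hW hm⟩⟩

instance hasKernel {V W : FIMod.{u} R} (f : V ⟶ W) : HasKernel f :=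
  Abelian.has_kernels.has_limit f

lemma shortExact_kernel {V W : FIMod.{u} R} (g : V ⟶ W) [Epi g] :
    (ShortComplex.mk (kernel.ι g) g (kernel.condition g)).ShortExact where
  exact := ShortComplex.exact_kernel g

/-- Given `E → T.X₂` onto with kernel `Z`, the kernel of `E → T.X₃` is generated in finite degrees,
and `Z` is the kernel of its surjection onto `T.X₁`. -/
lemma FinPres.ext {T : ShortComplex (FIMod.{u} R)} (hT : T.ShortExact) (h1 : FinPres T.X₁)
    (h3 : FinPres T.X₃) : FinPres T.X₂ := by
  refine ⟨FinGen.ext hT h1.1 h3.1, fun Z E z e w hE hfg => ?_⟩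
  have := hT.mono_f
  have := hT.epi_g
  have he : Epi e := hE.epi_g
  have hz : Mono z := hE.mono_f
  have : Epi (e ≫ T.g) := epi_comp e T.g
  have hk := shortExact_kernel (e ≫ T.g)
  have hK : FinGen (kernel (e ≫ T.g)) := h3.2 _ _ _ _ _ hk hfg
  let a : Z ⟶ kernel (e ≫ T.g) := kernel.lift _ z (by rw [← Category.assoc, w, zero_comp])
  have ha : a ≫ kernel.ι (e ≫ T.g) = z := kernel.lift_ι _ _ _
  obtain ⟨b, hb⟩ : ∃ b : kernel (e ≫ T.g) ⟶ T.X₁, b ≫ T.f = kernel.ι (e ≫ T.g) ≫ e :=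
    hT.exact.lift' _ (by rw [Category.assoc, kernel.condition])
  have hab : a ≫ b = 0 := by
    rw [← cancel_mono T.f, Category.assoc, hb, ← Category.assoc, ha, w, zero_comp]
  refine h1.2 Z _ a b hab ?_ hK
  refine shortExact_iff.2 fun S => ?_
  have eT := shortExact_iff.1 hT S
  have eE := shortExact_iff.1 hE S
  have eK := shortExact_iff.1 hk S
  have hb' (x) : (T.f.app S).hom ((b.app S).hom x) =
      (e.app S).hom (((kernel.ι (e ≫ T.g)).app S).hom x) :=
    congr_arg (fun t : kernel (e ≫ T.g) ⟶ T.X₂ => (t.app S).hom x) hb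
  have ha' (x) : ((kernel.ι (e ≫ T.g)).app S).hom ((a.app S).hom x) = (z.app S).hom x :=
    congr_arg (fun t : Z ⟶ E => (t.app S).hom x) ha
  have hab' (x) : (b.app S).hom ((a.app S).hom x) = 0 :=
    congr_arg (fun t : Z ⟶ T.X₁ => (t.app S).hom x) hab
  refine ⟨?_, ?_, ?_⟩
  · exact (mono_iff_injective a).1 (mono_of_mono_fac ha) S
  · intro x
    constructor
    · intro hx
      have h0 := hb' x
      rw [show (b.app S).hom x = 0 from hx, map_zero] at h0
      obtain ⟨y, hy⟩ := (eE.2.1 _).1 h0.symm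
      exact ⟨y, eK.1 ((ha' y).trans hy)⟩
    · rintro ⟨y, rfl⟩
      exact hab' y
  · intro x
    obtain ⟨y, hy⟩ := eE.2.2 ((T.f.app S).hom x)
    have h0 : ((e ≫ T.g).app S).hom y = 0 := by
      rw [comp_app_apply]
      refine (congr_arg (T.g.app S).hom hy).trans ?_
      exact (eT.2.1 _).2 ⟨x, rfl⟩
    obtain ⟨y', rfl⟩ := (eK.2.1 y).1 h0
    exact ⟨y', eT.1 ((hb' y').trans hy)⟩

lemma FinPres.of_derivative {N : FIMod.{u} R} (hN : FinGen N) (h0 : IsZero (kerShift R N))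
    (hd : FinPres ((derivative R).obj N)) : FinPres N :=
  ⟨hN, fun _ _ _ _ _ hE hfg => FinGen.of_derivative
    (hd.2 _ _ _ _ _ (shortExact_map_derivative hE h0) hfg.derivative)⟩

/-- Write `0 → N → P → V → 0`, `K` for the kernel of `V → ΣV`, and `I` for the image of `ΔN → ΔP`.
The induction hypothesis for `0 → I → ΔP → ΔV → 0` makes `I` finitely presented. Then `0 → K → ΔN →
I → 0` shows that `K` is generated in finite degrees, hence vanishes on large sets and is finitely
presented. So `ΔN` is finitely presented, and this lifts to `N` because `N → ΣN` is injective. -/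
lemma finPres_of_genBelow (n : ℕ) : ∀ {T : ShortComplex (FIMod.{u} R)}, T.ShortExact →
    SplitShift T.X₂ → GenBelow n T.X₂ → FinGen T.X₁ →
      FinPres T.X₁ ∧ ∃ m, VanishesFrom m (kerShift R T.X₃) := by
  induction n with
  | zero =>
    intro T hT hs hg hN
    have := hT.mono_f
    have := hT.epi_g
    have h2 : VanishesFrom 0 T.X₂ := by
      -- Generation below `0` forces the module to be zero, since each value is spanned by values on
      -- smaller sets.
      have (k : ℕ) : ∀ S : FI.{u}, Nat.card S.carrier = k → IsZero (T.X₂.obj S) := by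
        induction k using Nat.strong_induction_on with
        | _ k ih =>
          rintro S rfl
          have h : fromProper T.X₂ S ≤ ⊥ := fromProper_le fun A hA x => by
            have := ih (Nat.card A) (by
              have := Set.ncard_lt_ncard (Set.ssubset_univ_iff.2 hA)
              rwa [Set.ncard_univ] at this) (FI.sub A) rfl
            rw [isZero_obj_iff.1 this x, map_zero]
            exact zero_mem _
          rw [hg S (Nat.zero_le _)] at h
          exact isZero_obj_iff.2 fun x => (Submodule.mem_bot R).1 (h Submodule.mem_top)
      exact fun S _ => this _ S rfl
    exact ⟨(h2.of_mono T.f).finPres, 0, (h2.of_epi T.g).of_mono (kernel.ι _)⟩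
  | succ n ih =>
    intro T hT hs hg hN
    have := hT.mono_f
    have hKP := hs.isZero_kerShift
    obtain ⟨δ, w, hδ, hex⟩ := exists_exact_derivative hT hKP
    have : Epi (T.map (derivative R)).g := epi_map_derivative hT
    have hQ := (exact_map_derivative hT).shortExact_image_ι
    have hL := hex.shortExact_factorThruImage
    have hN' : FinGen (Abelian.image ((derivative R).map T.f)) :=
      hN.derivative.of_epi (Abelian.factorThruImage ((derivative R).map T.f))
    have hP := (ih hQ hs.derivative hg.derivative hN').1
    have hK : FinGen (kerShift R T.X₃) := hP.2 _ _ _ _ _ hL hN.derivative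
    obtain ⟨m, hm⟩ := hK
    have hm' := hm.vanishesFrom_kerShift
    refine ⟨FinPres.of_derivative hN ?_ (FinPres.ext hL hm'.finPres hP), m, hm'⟩
    have : Mono (shiftι T.X₁) := by
      obtain ⟨r, hr⟩ := hs
      have : Mono (shiftι T.X₂) := mono_of_mono_fac hr
      have : Mono (shiftι T.X₁ ≫ (shift R).map T.f) := by
        rw [shiftι_naturality]
        exact mono_comp _ _
      exact mono_of_mono _ ((shift R).map T.f)
    exact isZero_kernel_of_mono (shiftι T.X₁)

/-- `V` is a quotient of a split module generated in finite degrees by a submodule generated in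
finite degrees. -/
def SplitPresented (V : FIMod.{u} R) : Prop :=
  ∃ (N P : FIMod.{u} R) (f : N ⟶ P) (g : P ⟶ V) (w : f ≫ g = 0),
    (ShortComplex.mk f g w).ShortExact ∧ SplitShift P ∧ FinGen P ∧ FinGen N

lemma SplitPresented.vanishesFrom_kerShift {V : FIMod.{u} R} :
    SplitPresented V → ∃ m, VanishesFrom m (kerShift R V)
  | ⟨_, _, _, _, _, hT, hs, ⟨n, hn⟩, hN⟩ => (finPres_of_genBelow n hT hs hn hN).2

lemma SplitPresented.derivative {V : FIMod.{u} R} :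
    SplitPresented V → SplitPresented ((derivative R).obj V)
  | ⟨N, P, f, g, w, hT, hs, hP, hN⟩ => by
    have : Epi ((ShortComplex.mk f g w).map (FIMod.derivative R)).g := epi_map_derivative hT
    have hQ := (exact_map_derivative hT).shortExact_image_ι
    have hN' : FinGen (Abelian.image ((FIMod.derivative R).map f)) :=
      hN.derivative.of_epi (Abelian.factorThruImage ((FIMod.derivative R).map f))
    exact ⟨_, _, _, _, _, hQ, hs.derivative, hP.derivative, hN'⟩

lemma SplitPresented.iterDerivative {V : FIMod.{u} R} (hV : SplitPresented V) :
    ∀ a, SplitPresented ((iterDerivative R a).obj V)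
  | 0 => hV
  | a + 1 => (hV.iterDerivative a).derivative

end
end FIMod

namespace FIMod

section

variable {R : Type} [CommRing R]

/-! ### Free modules -/

/-- The free `FI`-module with generators `X k` on the sets `{0, …, k - 1}`. -/
noncomputable def free (R : Type) [CommRing R] (X : ℕ → Type u) : FIMod.{u} R where
  obj S := ModuleCat.of R ((Σ k, (FI.stdObj.{u} k ⟶ S) × X k) →₀ R)
  map f := ModuleCat.ofHom (Finsupp.lmapDomain R R fun p => ⟨p.1, p.2.1 ≫ f, p.2.2⟩)
  map_id S := by
    ext : 1
    refine Finsupp.lhom_ext' fun p => LinearMap.ext_ring ?_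
    simp
  map_comp f g := by
    ext : 1
    refine Finsupp.lhom_ext' fun p => LinearMap.ext_ring ?_
    simp

section

variable {X : ℕ → Type u}

/-- The basis elements of a free module. -/
noncomputable def freeBasis {k : ℕ} {S : FI.{u}} (f : FI.stdObj.{u} k ⟶ S) (x : X k) :
    (free R X).obj S :=
  Finsupp.single (⟨k, f, x⟩ : Σ k, (FI.stdObj.{u} k ⟶ S) × X k) (1 : R)

lemma free_map_basis {k : ℕ} {S T : FI.{u}} (f : FI.stdObj.{u} k ⟶ S) (g : S ⟶ T) (x : X k) :
    ((free R X).map g).hom (freeBasis f x) = freeBasis (f ≫ g) x :=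
  Finsupp.mapDomain_single

lemma free_linearMap_ext {S : FI.{u}} {M : Type u} [AddCommGroup M] [Module R M]
    {φ ψ : (free R X).obj S →ₗ[R] M}
    (h : ∀ (k : ℕ) (f : FI.stdObj.{u} k ⟶ S) (x : X k),
      φ (freeBasis f x) = ψ (freeBasis f x)) : φ = ψ :=
  Finsupp.lhom_ext' fun p => LinearMap.ext_ring (h p.1 p.2.1 p.2.2)

lemma free_le {S : FI.{u}} {N : Submodule R ((free R X).obj S)}
    (h : ∀ (k : ℕ) (f : FI.stdObj.{u} k ⟶ S) (x : X k), freeBasis f x ∈ N) : N = ⊤ := by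
  have : N.mkQ = 0 := free_linearMap_ext fun k f x => by
    simpa using h k f x
  rw [← N.ker_mkQ, this, LinearMap.ker_zero]

/-- The linear map on the value of a free module determined by the images of the basis. -/
noncomputable def freeLift {S : FI.{u}} {M : Type u} [AddCommGroup M] [Module R M]
    (v : ∀ k, (FI.stdObj.{u} k ⟶ S) → X k → M) : (free R X).obj S →ₗ[R] M :=
  Finsupp.linearCombination R
    (fun p : Σ k, (FI.stdObj.{u} k ⟶ S) × X k => v p.1 p.2.1 p.2.2)

lemma freeLift_basis {S : FI.{u}} {M : Type u} [AddCommGroup M] [Module R M]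
    (v : ∀ k, (FI.stdObj.{u} k ⟶ S) → X k → M) {k : ℕ} (f : FI.stdObj.{u} k ⟶ S) (x : X k) :
    freeLift v (freeBasis f x : (free R X).obj S) = v k f x := by
  refine (Finsupp.linearCombination_single R _ _).trans ?_
  exact one_smul _ _

/-- The morphism from a free module determined by the images of the generators. -/
noncomputable def freeDesc {V : FIMod.{u} R} (v : ∀ k, X k → V.obj (FI.stdObj k)) :
    free R X ⟶ V :=
  homMk (fun S => freeLift fun k f x => (V.map f).hom (v k x)) (by
    intro S T f x
    refine LinearMap.congr_fun
      (f := freeLift (fun k f x => (V.map f).hom (v k x)) ∘ₗ ((free R X).map f).hom)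
      (g := (V.map f).hom ∘ₗ freeLift fun k f x => (V.map f).hom (v k x))
      (free_linearMap_ext fun k g x => ?_) x
    rw [LinearMap.comp_apply, LinearMap.comp_apply, free_map_basis, freeLift_basis, freeLift_basis,
      map_comp_apply])

lemma freeDesc_basis {V : FIMod.{u} R} (v : ∀ k, X k → V.obj (FI.stdObj k)) {k : ℕ} {S : FI.{u}}
    (f : FI.stdObj.{u} k ⟶ S) (x : X k) :
    ((freeDesc v).app S).hom (freeBasis f x) = (V.map f).hom (v k x) :=
  freeLift_basis _ f x

instance projective_free : Projective (free R X) := by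
  refine ⟨fun {E W} f g hg => ?_⟩
  choose v hv using fun k (x : X k) => (epi_iff_surjective g).1 inferInstance (FI.stdObj k)
    ((f.app _).hom (freeBasis (𝟙 _) x))
  refine ⟨freeDesc v, ?_⟩
  ext S : 2
  ext1
  refine free_linearMap_ext fun k i x => ?_
  refine (congr_arg (g.app S).hom (freeDesc_basis v i x)).trans ?_
  rw [app_map_apply, hv, ← app_map_apply, free_map_basis, Category.id_comp]

lemma epi_freeDesc {V : FIMod.{u} R} (v : ∀ k, X k → V.obj (FI.stdObj k))
    (h : ∀ S : FI.{u}, Function.Surjective (v (Nat.card S.carrier)) ∨ fromProper V S = ⊤) :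
    Epi (freeDesc v) := by
  rw [epi_iff_surjective]
  have (k : ℕ) : ∀ S : FI.{u}, Nat.card S.carrier = k →
      Function.Surjective ((freeDesc v).app S).hom := by
    induction k using Nat.strong_induction_on with
    | _ k ih =>
      rintro S rfl
      obtain hs | hs := h S
      · intro y
        obtain ⟨e⟩ := FI.exists_iso_stdObj (S := S) rfl
        obtain ⟨x, hx⟩ := hs ((V.map e.inv).hom y)
        refine ⟨freeBasis e.hom x, ?_⟩
        rw [freeDesc_basis, hx, ← map_comp_apply, e.inv_hom_id, map_id_apply]
      · rw [← LinearMap.range_eq_top, eq_top_iff, ← hs]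
        refine fromProper_le fun A hA y => ?_
        have hc := Set.ncard_lt_ncard (Set.ssubset_univ_iff.2 hA)
        rw [Set.ncard_univ] at hc
        obtain ⟨z, rfl⟩ := ih (Nat.card A) hc (FI.sub A) rfl y
        exact ⟨_, app_map_apply _ _ z⟩
  exact fun S => this _ S rfl

lemma genBelow_free {n : ℕ} (h : ∀ k, n ≤ k → IsEmpty (X k)) : GenBelow n (free R X) := by
  intro S hS
  refine free_le fun k f x => ?_
  have hk : k < n := not_le.1 fun hk => (h k hk).false x
  rw [← Category.id_comp f, ← free_map_basis]
  refine range_map_le_fromProper _ f (fun hf => ?_) ⟨_, rfl⟩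
  have := Nat.card_le_card_of_surjective _ hf
  rw [FI.card_stdObj] at this
  omega

open Classical in
/-- The basis element of the restriction of `f` to `S`, and `0` if `f` hits the added point. -/
noncomputable def freeRestrict {S : FI.{u}} (k : ℕ) (f : FI.stdObj.{u} k ⟶ FI.addPoint.obj S)
    (x : X k) : (free R X).obj S :=
  if h : ∃ g : FI.stdObj.{u} k ⟶ S, g ≫ FI.inclPoint.app S = f then freeBasis h.choose x else 0

lemma freeRestrict_comp_inclPoint {S : FI.{u}} {k : ℕ} (g : FI.stdObj.{u} k ⟶ S) (x : X k) :
    (freeRestrict k (g ≫ FI.inclPoint.app S) x : (free R X).obj S) = freeBasis g x := by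
  have h : ∃ g' : FI.stdObj.{u} k ⟶ S, g' ≫ FI.inclPoint.app S = g ≫ FI.inclPoint.app S := ⟨g, rfl⟩
  rw [freeRestrict, dif_pos h]
  have : h.choose = g := FI.hom_ext fun y =>
    Option.some_injective _ (congr_fun (congr_arg FI.fn h.choose_spec) y)
  rw [this]

lemma freeRestrict_eq_zero {S : FI.{u}} {k : ℕ} {f : FI.stdObj.{u} k ⟶ FI.addPoint.obj S}
    {i : (FI.stdObj.{u} k).carrier} (hi : FI.fn f i = none) (x : X k) :
    (freeRestrict k f x : (free R X).obj S) = 0 := by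
  refine dif_neg ?_
  rintro ⟨g, rfl⟩
  cases hi

lemma exists_comp_inclPoint {U S : FI.{u}} (f : U ⟶ FI.addPoint.obj S) :
    (∃ g : U ⟶ S, g ≫ FI.inclPoint.app S = f) ∨ ∃ i, FI.fn f i = none := by
  by_cases h : ∃ i, FI.fn f i = none
  · exact Or.inr h
  · have h' (i : U.carrier) : ∃ s, some s = FI.fn f i := by
      obtain e | ⟨s, e⟩ := Option.eq_none_or_eq_some (FI.fn f i)
      · exact absurd ⟨i, e⟩ h
      · exact ⟨s, e.symm⟩
    choose g hg using h'
    exact Or.inl ⟨FI.ofInj g fun a b e => FI.fn_injective f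
      ((hg a).symm.trans ((congr_arg some e).trans (hg b))), FI.hom_ext hg⟩

/-- Basis elements meeting the added point are sent to zero. This is natural, since an injection
extended by `* ↦ *` preserves whether `*` is hit. -/
lemma splitShift_free : SplitShift (free R X) := by
  refine ⟨homMk (V := (shift R).obj (free R X)) (fun S => freeLift (S := FI.addPoint.obj S)
    fun k f x => freeRestrict k f x) ?_, ?_⟩
  · intro S T f x
    refine LinearMap.congr_fun
      (f := freeLift _ ∘ₗ ((free R X).map (FI.addPoint.map f)).hom)
      (g := ((free R X).map f).hom ∘ₗ freeLift _) (free_linearMap_ext fun k g x => ?_) x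
    rw [LinearMap.comp_apply, LinearMap.comp_apply, free_map_basis, freeLift_basis, freeLift_basis]
    obtain ⟨g', rfl⟩ | ⟨i, hi⟩ := exists_comp_inclPoint g
    · rw [Category.assoc, ← FI.inclPoint.naturality, ← Category.assoc, freeRestrict_comp_inclPoint,
        freeRestrict_comp_inclPoint, free_map_basis]
      rfl
    · rw [freeRestrict_eq_zero hi, map_zero]
      refine freeRestrict_eq_zero (i := i) ?_ x
      rw [FI.fn_comp, hi]
      rfl
  · ext S : 2
    ext1
    refine free_linearMap_ext fun k f x => ?_
    refine (congr_arg (freeLift fun k f x => freeRestrict k f x)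
      (free_map_basis f (FI.inclPoint.app S) x)).trans ?_
    rw [freeLift_basis, freeRestrict_comp_inclPoint]
    rfl

end

lemma Projective.splitShift (P : FIMod.{u} R) [Projective P] : SplitShift P := by
  let X : ℕ → Type u := fun k => P.obj (FI.stdObj k)
  let π : free R X ⟶ P := freeDesc fun k x => x
  have : Epi π := epi_freeDesc _ fun S => Or.inl fun x => ⟨x, rfl⟩
  let s : P ⟶ free R X := Projective.factorThru (𝟙 P) π
  have hs : s ≫ π = 𝟙 P := Projective.factorThru_comp _ _
  obtain ⟨r, hr⟩ := splitShift_free (R := R) (X := X)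
  refine ⟨(shift R).map s ≫ r ≫ π, ?_⟩
  rw [← Category.assoc, shiftι_naturality, Category.assoc, ← Category.assoc (shiftι _), hr,
    Category.id_comp, hs]

lemma GenBelow.exists_projective {n : ℕ} {V : FIMod.{u} R} (hV : GenBelow n V) :
    ∃ (N P : FIMod.{u} R) (f : N ⟶ P) (g : P ⟶ V) (w : f ≫ g = 0),
      (ShortComplex.mk f g w).ShortExact ∧ Projective P ∧ GenBelow n P := by
  -- The condition does not involve `x`: all elements are generators for `k < n`, none otherwise.
  let X : ℕ → Type u := fun k => {x : V.obj (FI.stdObj k) // k < n}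
  let π : free R X ⟶ V := freeDesc fun k x => x.1
  have : Epi π := epi_freeDesc _ fun S => by
    by_cases h : n ≤ Nat.card S.carrier
    · exact Or.inr (hV S h)
    · exact Or.inl fun x => ⟨⟨x, not_le.1 h⟩, rfl⟩
  exact ⟨_, _, _, π, _, shortExact_kernel π, inferInstance,
    genBelow_free fun k hk => ⟨fun x => absurd x.2 (not_lt.2 hk)⟩⟩

/-! ### Homology -/

lemma isZero_homologyZero_iff {V : FIMod.{u} R} {S : FI.{u}} :
    IsZero ((homologyZero R ⋙ eval R S).obj V) ↔ fromProper V S = ⊤ := by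
  refine (isZero_obj_iff (V := (homologyZero R).obj V)).trans ?_
  rw [eq_top_iff]
  constructor
  · exact fun h x _ => (Submodule.Quotient.mk_eq_zero _).1 (h (Submodule.Quotient.mk x))
  · intro h x
    obtain ⟨y, rfl⟩ := Submodule.Quotient.mk_surjective (fromProper V S) x
    exact (Submodule.Quotient.mk_eq_zero _).2 (h Submodule.mem_top)

instance (S : FI.{u}) : PreservesFiniteColimits (homologyZero.{u} R ⋙ eval R S) := by
  refine ((homologyZero R ⋙ eval R S).preservesFiniteColimits_tfae.out 0 3 :).1 fun T hT => ?_
  have h := shortExact_iff.1 hT S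
  have := hT.epi_g
  constructor
  · rw [ShortComplex.ShortExact.moduleCat_exact_iff_function_exact]
    intro y
    obtain ⟨y, rfl⟩ := Submodule.Quotient.mk_surjective (fromProper T.X₂ S) y
    constructor
    · intro hy
      have hy' : (T.g.app S).hom y ∈ fromProper T.X₃ S := (Submodule.Quotient.mk_eq_zero _).1 hy
      obtain ⟨y', hy', e⟩ := fromProper_le_map_app T.g S hy'
      obtain ⟨x, hx⟩ := (h.2.1 (y - y')).1 (by rw [map_sub, e, sub_self])
      refine ⟨Submodule.Quotient.mk x, (Submodule.Quotient.eq _).2 ?_⟩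
      rw [hx, sub_sub_cancel_left]
      exact neg_mem hy'
    · rintro ⟨x, hx⟩
      obtain ⟨x, rfl⟩ := Submodule.Quotient.mk_surjective (fromProper T.X₁ S) x
      rw [← hx]
      refine (Submodule.Quotient.mk_eq_zero _).2 ?_
      rw [(h.2.1 _).2 ⟨x, rfl⟩]
      exact zero_mem _
  · refine (ModuleCat.epi_iff_surjective _).2 fun y => ?_
    obtain ⟨y, rfl⟩ := Submodule.Quotient.mk_surjective (fromProper T.X₃ S) y
    obtain ⟨x, rfl⟩ := h.2.2 y
    exact ⟨Submodule.Quotient.mk x, rfl⟩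

lemma isZero_homology_iff {i : ℕ} {V : FIMod.{u} R} {S : FI.{u}} :
    IsZero (((homology R i).obj V).obj S) ↔
      IsZero (((homologyZero R ⋙ eval R S).leftDerived i).obj V) :=
  ((homologyZero R).leftDerivedCompObjIso (eval R S) i V).isZero_iff.symm

/-- Vanishing of `H_0` bounds the generators of `V`, hence of a free cover `P`. Where `H_1(V)`
vanishes, `H_0(N) → H_0(P)` is injective, and its target is zero on sets of size at least `n`. -/
lemma splitPresented_of_vanishesFrom {V : FIMod.{u} R} {n m : ℕ}
    (h0 : VanishesFrom n ((homology R 0).obj V)) (h1 : VanishesFrom m ((homology R 1).obj V)) :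
    SplitPresented V := by
  have hV : GenBelow n V := fun S hS => isZero_homologyZero_iff.1
    (((homologyZero R ⋙ eval R S).leftDerivedZeroIsoSelf.app V).isZero_iff.1
      (isZero_homology_iff.1 (h0 S hS)))
  obtain ⟨N, P, f, g, w, hT, hP, hg⟩ := hV.exists_projective
  refine ⟨N, P, f, g, w, hT, Projective.splitShift P, ⟨n, hg⟩, max n m, fun S hS => ?_⟩
  have hm := (hT.isZero_leftDerived_one_iff (homologyZero R ⋙ eval R S) hP).1
    (isZero_homology_iff.1 (h1 S ((le_max_right _ _).trans hS)))
  have hz := isZero_homologyZero_iff.2 (hg S ((le_max_left _ _).trans hS))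
  exact isZero_homologyZero_iff.1 (hz.of_mono ((homologyZero R ⋙ eval R S).map f))

end
end FIMod

namespace FIMod

section

variable {R : Type} [CommRing R]

/-! ### Derived functors of iterated derivatives -/

instance preservesFiniteColimits_iterDerivative :
    ∀ a : ℕ, PreservesFiniteColimits (iterDerivative.{u} R a)
  | 0 => inferInstanceAs (PreservesFiniteColimits (𝟭 (FIMod.{u} R)))
  | a + 1 =>
    have := preservesFiniteColimits_iterDerivative a
    comp_preservesFiniteColimits (iterDerivative.{u} R a) (derivative R)

lemma SplitShift.iterDerivative {P : FIMod.{u} R} (hP : SplitShift P) :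
    ∀ a, SplitShift ((iterDerivative R a).obj P)
  | 0 => hP
  | a + 1 => (hP.iterDerivative a).derivative

/-- Vanishing of the `i`-th left derived functor of the `a`-fold derivative at `S`. -/
def DDVanishes (a i : ℕ) (V : FIMod.{u} R) (S : FI.{u}) : Prop :=
  IsZero (((derivedDerivative R a i).obj V).obj S)

lemma ddVanishes_iff {a i : ℕ} {V : FIMod.{u} R} {S : FI.{u}} :
    DDVanishes a i V S ↔ IsZero (((iterDerivative R a ⋙ eval R S).leftDerived i).obj V) :=
  ((iterDerivative R a).leftDerivedCompObjIso (eval R S) i V).isZero_iff.symm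

lemma ddVanishes_one_iff {T : ShortComplex (FIMod.{u} R)} (hT : T.ShortExact)
    (hP : Projective T.X₂) {a : ℕ} {S : FI.{u}} :
    DDVanishes a 1 T.X₃ S ↔ Function.Injective (((iterDerivative R a).map T.f).app S).hom := by
  have : PreservesFiniteColimits (iterDerivative R a ⋙ eval R S) :=
    comp_preservesFiniteColimits _ _
  rw [ddVanishes_iff, hT.isZero_leftDerived_one_iff _ hP, ModuleCat.mono_iff_injective]
  rfl

lemma ddVanishes_add_two_iff {T : ShortComplex (FIMod.{u} R)} (hT : T.ShortExact)
    (hP : Projective T.X₂) {a : ℕ} {S : FI.{u}} (i : ℕ) :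
    DDVanishes a (i + 2) T.X₃ S ↔ DDVanishes a (i + 1) T.X₁ S := by
  rw [ddVanishes_iff, ddVanishes_iff, hT.isZero_leftDerived_iff _ hP]

lemma exists_projective_shortExact (V : FIMod.{u} R) : ∃ (N P : FIMod.{u} R) (f : N ⟶ P)
    (g : P ⟶ V) (w : f ≫ g = 0), Projective P ∧ (ShortComplex.mk f g w).ShortExact :=
  ⟨_, _, _, Projective.π V, _, inferInstance, shortExact_kernel (Projective.π V)⟩

lemma ddVanishes_zero_succ (i : ℕ) : ∀ (V : FIMod.{u} R) (S : FI.{u}),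
    DDVanishes 0 (i + 1) V S := by
  induction i with
  | zero =>
    intro V S
    obtain ⟨N, P, f, g, w, hP, hT⟩ := exists_projective_shortExact V
    exact (ddVanishes_one_iff hT hP).2 (shortExact_iff.1 hT S).1
  | succ i ih =>
    intro V S
    obtain ⟨N, P, f, g, w, hP, hT⟩ := exists_projective_shortExact V
    exact (ddVanishes_add_two_iff hT hP i).2 (ih N S)

/-- A diagram chase with `F = Δ^a` on `0 → N → P → V → 0`. An element of `F N` at `S ⊔ {*}` that
dies in `ΔF P` agrees in `F P` with some `y` coming from `S`; by `h0` the image of `y` in `F V` is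
zero, so `y` lifts to `F N`. -/
lemma DDVanishes.succ_one {a : ℕ} {V : FIMod.{u} R} {S : FI.{u}}
    (h : DDVanishes a 1 V (FI.addPoint.obj S))
    (h0 : ∀ x, ((shiftι ((iterDerivative R a).obj V)).app S).hom x = 0 → x = 0) :
    DDVanishes (a + 1) 1 V S := by
  obtain ⟨N, P, f, g, w, hP, hT⟩ := exists_projective_shortExact V
  have hi := (ddVanishes_one_iff hT hP).1 h
  refine (ddVanishes_one_iff hT hP).2 ((injective_iff_map_eq_zero _).2 fun x hx => ?_)
  let F := iterDerivative R a
  have hF := ((F.preservesFiniteColimits_tfae.out 3 0 :).1 inferInstance) _ hT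
  have hE := exact_iff.1 hF.1 S
  obtain ⟨x, rfl⟩ := shiftπ_surjective (F.obj N) S x
  have hx1 : ((shiftπ (F.obj P)).app S).hom (((F.map f).app (FI.addPoint.obj S)).hom x) = 0 := by
    refine Eq.trans ?_ hx
    exact congr_arg (fun t : (shift R).obj (F.obj N) ⟶ (derivative R).obj (F.obj P) =>
      (t.app S).hom x) (shiftπ_naturality (F.map f)).symm
  obtain ⟨y, hy⟩ := (shiftπ_eq_zero_iff _ S _).1 hx1
  obtain ⟨z, hz⟩ : ∃ z, ((F.map f).app S).hom z = y := by
    refine (hE y).1 (h0 _ ?_)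
    refine (app_map_apply (F.map g) (FI.inclPoint.app S) y).symm.trans ?_
    rw [hy]
    exact (exact_iff.1 hF.1 (FI.addPoint.obj S) _).2 ⟨x, rfl⟩
  refine (shiftπ_eq_zero_iff _ S _).2 ⟨z, hi ?_⟩
  refine (app_map_apply (F.map f) (FI.inclPoint.app S) z).trans ?_
  exact (congr_arg ((F.obj P).map (FI.inclPoint.app S)).hom hz).trans hy

/-- Dimension shifting reduces to `succ_one` for the syzygy `N`. Its kernel condition holds because
`Δ^a N → Δ^a P` is injective at `S` and `Δ^a P` embeds in its shift. -/
lemma DDVanishes.succ {a : ℕ} {S : FI.{u}} (i : ℕ) : ∀ {V : FIMod.{u} R},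
    DDVanishes a (i + 2) V (FI.addPoint.obj S) → DDVanishes a (i + 1) V S →
      DDVanishes (a + 1) (i + 2) V S := by
  induction i with
  | zero =>
    intro V h2 h1
    obtain ⟨N, P, f, g, w, hP, hT⟩ := exists_projective_shortExact V
    refine (ddVanishes_add_two_iff hT hP 0).2
      (((ddVanishes_add_two_iff hT hP 0).1 h2).succ_one fun x hx => ?_)
    refine (injective_iff_map_eq_zero _).1 ((ddVanishes_one_iff hT hP).1 h1) x ?_
    obtain ⟨r, hr⟩ := (Projective.splitShift P).iterDerivative a
    have hm : Mono (shiftι ((iterDerivative R a).obj P)) := mono_of_mono_fac hr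
    refine (injective_iff_map_eq_zero _).1 ((mono_iff_injective _).1 hm S) _ ?_
    refine (app_map_apply ((iterDerivative R a).map f) (FI.inclPoint.app S) x).symm.trans ?_
    exact (congr_arg _ hx).trans (map_zero _)
  | succ i ih =>
    intro V h2 h1
    obtain ⟨N, P, f, g, w, hP, hT⟩ := exists_projective_shortExact V
    exact (ddVanishes_add_two_iff hT hP _).2 (ih ((ddVanishes_add_two_iff hT hP _).1 h2)
      ((ddVanishes_add_two_iff hT hP _).1 h1))

/-! ### Comparison with local cohomology -/

lemma exists_not_lcVanishes_of_iterDerivative {V : FIMod.{u} R} (hV : SplitPresented V) (a : ℕ) :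
    ∀ (m : ℕ) (S : FI.{u}), ¬ LCVanishes m ((iterDerivative R a).obj V) S →
      ∃ (j : ℕ) (T : FI.{u}), j ≤ m + a ∧ ¬ LCVanishes j V T ∧
        Nat.card S.carrier + m + a ≤ Nat.card T.carrier + j := by
  induction a with
  | zero => exact fun m S h => ⟨m, S, le_rfl, h, le_rfl⟩
  | succ a ih =>
    intro m S h
    obtain ⟨n, hn⟩ := (hV.iterDerivative a).vanishesFrom_kerShift
    by_cases h1 : LCVanishes m ((iterDerivative R a).obj V) (FI.addPoint.obj S)
    · by_cases h2 : LCVanishes (m + 1) ((iterDerivative R a).obj V) S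
      · exact absurd (LCVanishes.derivative hn h1 h2) h
      · obtain ⟨j, T, hj, hT, hc⟩ := ih _ _ h2
        exact ⟨j, T, by omega, hT, by omega⟩
    · obtain ⟨j, T, hj, hT, hc⟩ := ih _ _ h1
      rw [FI.card_addPoint] at hc
      exact ⟨j, T, by omega, hT, by omega⟩

lemma exists_not_lcVanishes_of_derivedDerivative {V : FIMod.{u} R} (hV : SplitPresented V)
    (a : ℕ) : ∀ (i : ℕ) (S : FI.{u}), ¬ DDVanishes a (i + 1) V S →
      ∃ (j : ℕ) (T : FI.{u}), j + (i + 1) ≤ a ∧ ¬ LCVanishes j V T ∧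
        Nat.card S.carrier + a ≤ Nat.card T.carrier + j + (i + 1) := by
  induction a with
  | zero => exact fun i S h => absurd (ddVanishes_zero_succ i V S) h
  | succ a ih =>
    intro i S h
    by_cases h1 : DDVanishes a (i + 1) V (FI.addPoint.obj S)
    · cases i with
      | zero =>
        have h2 : ¬ LCVanishes 0 ((iterDerivative R a).obj V) S := fun h2 =>
          -- An element killed by `S ⊆ S ⊔ {*}` is torsion, so it is detected by `H^0`.
          h (h1.succ_one fun x hx => lcVanishes_zero_iff.1 h2 x ⟨_, FI.inclPoint.app S, hx⟩)
        obtain ⟨j, T, hj, hT, hc⟩ := exists_not_lcVanishes_of_iterDerivative hV a 0 S h2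
        exact ⟨j, T, by omega, hT, by omega⟩
      | succ i =>
        have h2 : ¬ DDVanishes a (i + 1) V S := fun h2 => h (h1.succ i h2)
        obtain ⟨j, T, hj, hT, hc⟩ := ih _ _ h2
        exact ⟨j, T, by omega, hT, by omega⟩
    · obtain ⟨j, T, hj, hT, hc⟩ := ih _ _ h1
      rw [FI.card_addPoint] at hc
      exact ⟨j, T, by omega, hT, by omega⟩

end
end FIMod

namespace FIMod

section

variable {R : Type} [CommRing R]

/-! ### Degrees -/

lemma deg_le {W : FIMod.{u} R} {d : WithTop ℤ} (hd : -1 ≤ d)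
    (h : ∀ S : FI.{u}, d < (Nat.card S.carrier : WithTop ℤ) → IsZero (W.obj S)) : deg W ≤ d :=
  -- The constraint `-1 ≤ d` in `deg` is what bounds the set from below.
  csInf_le ⟨-1, fun _ hx => hx.1⟩ ⟨hd, h⟩

lemma card_le_deg {W : FIMod.{u} R} {S : FI.{u}} (h : ¬ IsZero (W.obj S)) :
    (Nat.card S.carrier : WithTop ℤ) ≤ deg W :=
  le_csInf ⟨⊤, le_top, fun _ hS => absurd hS not_top_lt⟩
    fun _ hd => not_lt.1 fun hlt => h (hd.2 S hlt)

lemma deg_nonneg {W : FIMod.{u} R} {S : FI.{u}} (h : ¬ IsZero (W.obj S)) : 0 ≤ deg W := by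
  refine le_trans ?_ (card_le_deg h)
  exact_mod_cast Nat.zero_le _

lemma exists_not_isZero_of_deg_nonneg {W : FIMod.{u} R} (h : 0 ≤ deg W) :
    ∃ S, ¬ IsZero (W.obj S) := by
  by_contra! hW
  exact absurd (h.trans (deg_le le_rfl fun S _ => hW S)) (by decide)

lemma exists_vanishesFrom_of_deg_ne_top {W : FIMod.{u} R} (h : deg W ≠ ⊤) :
    ∃ n, VanishesFrom n W := by
  obtain ⟨k, hk⟩ := WithTop.ne_top_iff_exists.1 h
  refine ⟨(k + 1).toNat, fun S hS => ?_⟩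
  by_contra hW
  have h1 := card_le_deg hW
  rw [← hk] at h1
  have h2 : (Nat.card S.carrier : ℤ) ≤ k := by exact_mod_cast h1
  omega

lemma deg_add_le {W : FIMod.{u} R} {c : ℕ} {M : WithTop ℤ} {S₀ : FI.{u}}
    (h₀ : ¬ IsZero (W.obj S₀))
    (h : ∀ S : FI.{u}, ¬ IsZero (W.obj S) →
      ((Nat.card S.carrier + c : ℕ) : WithTop ℤ) ≤ M) : deg W + (c : WithTop ℤ) ≤ M := by
  induction M with
  | top => exact le_top
  | coe k =>
    have h' (S : FI.{u}) (hS : ¬ IsZero (W.obj S)) : (Nat.card S.carrier : ℤ) + c ≤ k := by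
      exact_mod_cast h S hS
    have h1 : deg W ≤ ((k - c : ℤ) : WithTop ℤ) := by
      refine deg_le ?_ fun S hS => ?_
      · have := h' S₀ h₀
        -- The nonzero value at `S₀` is needed here: it gives `c ≤ k`, so `k - c` is an admissible
        -- degree.
        have : (-1 : ℤ) ≤ k - c := by omega
        exact WithTop.coe_le_coe.2 this
      · by_contra hW
        have h2 : k - c < (Nat.card S.carrier : ℤ) := by exact_mod_cast hS
        have := h' S hW
        omega
    refine (add_le_add_left h1 _).trans_eq ?_
    have : k - c + (c : ℤ) = k := by omega
    exact_mod_cast congr_arg (fun t : ℤ => (t : WithTop ℤ)) this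

lemma PresentedInFiniteDegrees.splitPresented {V : FIMod.{u} R}
    (hV : PresentedInFiniteDegrees V) : SplitPresented V := by
  obtain ⟨n, hn⟩ := exists_vanishesFrom_of_deg_ne_top hV.1
  obtain ⟨m, hm⟩ := exists_vanishesFrom_of_deg_ne_top hV.2
  exact splitPresented_of_vanishesFrom hn hm

/-- Common to both inequalities, with `e = 0` in the first and `e = i` in the second. The bound `N`
makes the set finite and `S₀` makes it nonempty, so the maximum exists even if some degree is `⊤`.
-/
lemma exists_isGreatest_of_pointwise {V W : FIMod.{u} R} {p : ℕ → Prop} {N c e : ℕ}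
    (hp : ∀ j, p j → j ≤ N) {S₀ : FI.{u}} (h₀ : ¬ IsZero (W.obj S₀))
    (hW : ∀ S : FI.{u}, ¬ IsZero (W.obj S) → ∃ (j : ℕ) (T : FI.{u}), p j ∧ ¬ LCVanishes j V T ∧
      Nat.card S.carrier + c ≤ Nat.card T.carrier + j + e) :
    ∃ M : WithTop ℤ,
      IsGreatest {x | ∃ j : ℕ, 0 ≤ h j V ∧ p j ∧ x = h j V + (j : WithTop ℤ) + (e : WithTop ℤ)} M ∧
      deg W + (c : WithTop ℤ) ≤ M := by
  have hfin : {x | ∃ j : ℕ, 0 ≤ h j V ∧ p j ∧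
      x = h j V + (j : WithTop ℤ) + (e : WithTop ℤ)}.Finite := by
    refine ((Set.finite_Iic N).image
      fun j => h j V + (j : WithTop ℤ) + (e : WithTop ℤ)).subset ?_
    rintro _ ⟨j, _, hj, rfl⟩
    exact ⟨j, hp j hj, rfl⟩
  have hne : {x | ∃ j : ℕ, 0 ≤ h j V ∧ p j ∧
      x = h j V + (j : WithTop ℤ) + (e : WithTop ℤ)}.Nonempty := by
    obtain ⟨j, T, hj, hT, -⟩ := hW S₀ h₀
    exact ⟨_, j, deg_nonneg hT, hj, rfl⟩
  obtain ⟨M, hM, hmax⟩ := Set.exists_max_image _ id hfin hne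
  refine ⟨M, ⟨hM, hmax⟩, deg_add_le h₀ fun S hS => ?_⟩
  obtain ⟨j, T, hj, hT, hc⟩ := hW S hS
  refine le_trans ?_ (hmax _ ⟨j, deg_nonneg hT, hj, rfl⟩)
  have hc' : ((Nat.card S.carrier + c : ℕ) : WithTop ℤ) ≤
      (Nat.card T.carrier : WithTop ℤ) + (j : WithTop ℤ) + (e : WithTop ℤ) := by
    exact_mod_cast hc
  exact hc'.trans (add_le_add_left (add_le_add_left (card_le_deg hT) _) _)

end
end FIMod

/-! ### The two degree inequalities -/

theorem mainTheorem2 (V : FIMod.{u} ℤ) (hV : FIMod.PresentedInFiniteDegrees V) :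
    (∀ a m : ℕ, 0 ≤ FIMod.h m ((FIMod.iterDerivative ℤ a).obj V) →
      ∃ M : WithTop ℤ,
        IsGreatest {x | ∃ j : ℕ, 0 ≤ FIMod.h j V ∧ j ≤ m + a ∧ x = FIMod.h j V + (j : WithTop ℤ)} M ∧
        FIMod.h m ((FIMod.iterDerivative ℤ a).obj V) + (m : WithTop ℤ) + (a : WithTop ℤ) ≤ M) ∧
    (∀ a i : ℕ, 1 ≤ a → 1 ≤ i → ¬ IsZero ((FIMod.derivedDerivative ℤ a i).obj V) →
      ∃ M : WithTop ℤ,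
        IsGreatest {x | ∃ j : ℕ, 0 ≤ FIMod.h j V ∧ (j : ℤ) ≤ (a : ℤ) - (i : ℤ) ∧
          x = FIMod.h j V + (j : WithTop ℤ) + (i : WithTop ℤ)} M ∧
        FIMod.deg ((FIMod.derivedDerivative ℤ a i).obj V) + (a : WithTop ℤ) ≤ M) := by
  have hs := hV.splitPresented
  constructor
  · intro a m hm
    obtain ⟨S₀, h₀⟩ := FIMod.exists_not_isZero_of_deg_nonneg hm
    have key := FIMod.exists_isGreatest_of_pointwise (V := V)
      (W := (FIMod.localCohomology ℤ m).obj ((FIMod.iterDerivative ℤ a).obj V))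
      (p := fun j => j ≤ m + a) (N := m + a) (c := m + a) (e := 0) (fun _ hj => hj) h₀
      fun S hS => by
        obtain ⟨j, T, hj, hT, hc⟩ := FIMod.exists_not_lcVanishes_of_iterDerivative hs a m S hS
        exact ⟨j, T, hj, hT, by omega⟩
    simp only [Nat.cast_add, Nat.cast_zero, add_zero, ← add_assoc] at key
    exact key
  · intro a i _ hi h
    obtain ⟨i, rfl⟩ := Nat.exists_eq_add_of_le' hi
    obtain ⟨S₀, h₀⟩ : ∃ S₀, ¬ IsZero (((FIMod.derivedDerivative ℤ a (i + 1)).obj V).obj S₀) := by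
      by_contra! h0
      exact h ((Functor.isZero_iff _).2 h0)
    refine FIMod.exists_isGreatest_of_pointwise (N := a) (fun j hj => by omega) h₀ fun S hS => ?_
    obtain ⟨j, T, hj, hT, hc⟩ := FIMod.exists_not_lcVanishes_of_derivedDerivative hs a i S hS
    exact ⟨j, T, by omega, hT, hc⟩
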